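/- Let $\lambda\ge 0$ and write $(a)_n=a(a+1)\cdots(a+n-1)$, $(a)_0=1$. For $n\ge 0$ put $$\phi_n(z)=\epsilon_n\sum_{j=0}^{n}\frac{(\lambda)_j(\lambda+1)_{n-j}}{j!\,(n-j)!}\,\bar z^{\,j}z^{n-j},\qquad \epsilon_n=\sqrt{\frac{n!}{(2\lambda+1)_n}},$$ and let $C(z,w)=\sum_{n=0}^{\infty}\phi_n(z)\overline{\phi_n(w)}$ be the $\lambda$-Cauchy kernel. For $z,w$ in the open unit disk $\mathbb D$ this series converges absolutely, and for all $\theta\in\mathbb R$ and $w\in\mathbb D$ the function $r\mapsto C(re^{i\theta},w)$ is $C^\infty$ on $(-1,1)$. Moreover, for every integer $m\ge 1$ there is a constant $c>0$, depending only on $\lambda$ and $m$, such that for all $z=re^{i\theta}\in\mathbb D$ ($0\le r<1$, $\theta\in\mathbb R$) and all $w\in\mathbb D$, $$\left|\left(r\frac{\partial}{\partial r}\right)^m\big[C(z,w)\big]\right|\le c\,\frac{\big(|1-z\bar w|+|1-zw|\big)^{-2\lambda}}{|1-z\bar w|}\left(\frac{1}{|1-z\bar w|^{m}}+\frac{1}{|1-zw|^{m}}\right).$$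 -/

import Mathlib

open scoped ComplexConjugate ContDiff

/-- The normalising constant `ε_n = √(n! / (2λ+1)_n)`, where `(a)_n = a (a+1) ⋯ (a+n-1)`. -/
noncomputable def lamEps (lam : ℝ) (n : ℕ) : ℝ :=
  Real.sqrt ((Nat.factorial n : ℝ) / (ascPochhammer ℝ n).eval (2 * lam + 1))

/-- The basic `λ`-analytic function
`φ_n(z) = ε_n ∑_{j=0}^n (λ)_j (λ+1)_{n-j} / (j! (n-j)!) · z̄^j z^{n-j}`. -/
noncomputable def lamPhi (lam : ℝ) (n : ℕ) (z : ℂ) : ℂ :=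
  (lamEps lam n : ℂ) * ∑ j ∈ Finset.range (n + 1),
    (((ascPochhammer ℝ j).eval lam * (ascPochhammer ℝ (n - j)).eval (lam + 1) /
      ((Nat.factorial j : ℝ) * (Nat.factorial (n - j) : ℝ)) : ℝ) : ℂ) *
      conj z ^ j * z ^ (n - j)

/-- The `λ`-Cauchy kernel `C(z,w) = ∑_{n ≥ 0} φ_n(z) \overline{φ_n(w)}`. -/
noncomputable def lamCauchy (lam : ℝ) (z w : ℂ) : ℂ :=
  ∑' n : ℕ, lamPhi lam n z * conj (lamPhi lam n w)

/-- The operator `r ∂_r` on functions of a real variable `r`. -/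
noncomputable def eulerOp (g : ℝ → ℂ) : ℝ → ℂ := fun r => (r : ℂ) * deriv g r

/-- The point `r e^{iθ}`. -/
noncomputable def polarPt (r θ : ℝ) : ℂ := (r : ℂ) * Complex.exp ((θ : ℂ) * Complex.I)

/-!
For `λ > 0` the proof rests on two integral representations of the kernel. Put `q = e^{iθ}`,
`z = r q`, and let `μ` be the beta distribution with parameters `λ + 1`, `λ`; for `λ = 0` the unit
mass at `1` takes its place (`IsKernelMeasure`, `exists_isKernelMeasure`).

*First representation.* `φ_n` is `ε_n` times the coefficient of `τ^n` in
`(1 - τ z)^{-λ-1} (1 - τ z̄)^{-λ}`, and the moments of the beta distribution show that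
`ε_n φ_n(z) = ∫ (t z + (1 - t) z̄)^n dμ(t)`. Summing the binomial series gives
`C(z, w) = ∫ (1 - Z_t w̄)^{-λ-1} (1 - Z_t w)^{-λ} dμ(t)` with `Z_t = t z + (1 - t) z̄`
(`IsKernelMeasure.lamCauchy_eq_integral_segment`). This yields the absolute convergence, but it is
useless for the estimate: `Z_t w` can be much closer to `1` than `z w` and `z w̄` are.

*Second representation.* The integrand above has four branch points, and a Möbius change of variable
brings it into the form
`C(z, w) = (1 - z w̄)⁻¹ ∫ ((1 - t) |1 - z w̄|² + t |1 - z w|²)^{-λ} dμ(t)`.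
The change of variable leaves the real axis. For small `r` it is carried out by moving a parameter
`e` from `1` to its final value: the derivative in `e` of the transformed integrand is an exact
derivative in `t` with vanishing boundary terms (`integral_betaMeasure_moebius`). Both sides are
holomorphic in `r` in the unit disk, so the identity theorem extends the formula to all `r`
(`IsKernelMeasure.lamCauchy_polarPt`); it also shows that the kernel is smooth along diameters.

*Derivatives.* Write `F = (1 - t) |1 - z w̄|² + t |1 - z w|² = (1 - r ζ) (1 - r ζ̄)` with
`|ζ| = |w|`. The integrand is then a product of powers of functions `1 - r b`, and `r ∂_r` maps such
a product to a combination, with constant coefficients, of products with exponents lowered by at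
most `1` (`exists_eulerOp_iterate_powInt`). With `A = |1 - z w̄|` and `B = |1 - z w|` it remains to
bound `∫ A^{-1-i} F^{-λ-j/2} dμ` for `i + j ≤ m`, which is elementary
(`IsKernelMeasure.exists_integral_le`). The hypothesis `m ≥ 1` enters here: where `B` is small
compared with `A`, the integral of `F^{-λ}` carries a factor `log (A / B)`, whereas that of
`F^{-λ-1/2}` does not.
-/

/-! ### The bivariate coefficients -/

/-- The homogeneous polynomial `∑_{j ≤ n} (λ)_j (λ+1)_{n-j} / (j! (n-j)!) · y^j x^{n-j}`, so that
`φ_n(z)` is `ε_n` times its value at `x = z`, `y = z̄`. -/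
noncomputable def lamPoly (lam : ℝ) (n : ℕ) (x y : ℂ) : ℂ :=
  ∑ j ∈ Finset.range (n + 1),
    (((ascPochhammer ℝ j).eval lam * (ascPochhammer ℝ (n - j)).eval (lam + 1) /
      ((Nat.factorial j : ℝ) * (Nat.factorial (n - j) : ℝ)) : ℝ) : ℂ) * y ^ j * x ^ (n - j)

theorem lamPhi_eq (lam : ℝ) (n : ℕ) (z : ℂ) :
    lamPhi lam n z = (lamEps lam n : ℂ) * lamPoly lam n z (conj z) := rfl

theorem lamPoly_smul (lam : ℝ) (n : ℕ) (r x y : ℂ) :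
    lamPoly lam n (r * x) (r * y) = r ^ n * lamPoly lam n x y := by
  unfold lamPoly
  rw [Finset.mul_sum]
  refine Finset.sum_congr rfl fun j hj => ?_
  have : r ^ n = r ^ j * r ^ (n - j) := by
    rw [← pow_add, Nat.add_sub_cancel' (Nat.lt_succ_iff.mp (Finset.mem_range.mp hj))]
  rw [this, mul_pow, mul_pow]
  ring

theorem conj_lamPoly (lam : ℝ) (n : ℕ) (x y : ℂ) :
    conj (lamPoly lam n x y) = lamPoly lam n (conj x) (conj y) := by
  unfold lamPoly
  simp only [map_sum, map_mul, Complex.conj_ofReal, map_pow]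

/-- The `n`-th term of the binomial series of `(1 - z) ^ (-a)`. -/
noncomputable def binomTerm (a : ℝ) (z : ℂ) (n : ℕ) : ℂ :=
  (((ascPochhammer ℝ n).eval a / (Nat.factorial n : ℝ) : ℝ) : ℂ) * z ^ n

/-- The binomial series of `(1 - z) ^ (-a)`, with coefficients written as `(a)_n / n!`. -/
theorem hasSum_one_sub_cpow_neg (a : ℝ) {z : ℂ} (hz : ‖z‖ < 1) :
    HasSum (binomTerm a z) ((1 - z) ^ ((-a : ℝ) : ℂ)) := by
  have h := (Complex.one_div_one_sub_cpow_hasFPowerSeriesOnBall_zero (a : ℂ)).hasSum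
    (y := z) (by simpa [enorm_eq_nnnorm] using! hz)
  have hc : ∀ n : ℕ, Ring.choose ((a : ℂ) + n - 1) n =
      (((ascPochhammer ℝ n).eval a / (Nat.factorial n : ℝ) : ℝ) : ℂ) := by
    intro n
    have h1 : (a : ℂ) + n - 1 = ((a + n - 1 : ℝ) : ℂ) := by push_cast; ring
    rw [h1, ← Complex.ofReal_choose]
    congr 1
    rw [eq_div_iff (by positivity), mul_comm, ← nsmul_eq_mul]
    have h2 := Ring.factorial_nsmul_multichoose_eq_ascPochhammer a n
    rw [Polynomial.ascPochhammer_smeval_eq_eval] at h2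
    rw [← h2]
    unfold Ring.choose
    congr 2
    ring
  simp only [FormalMultilinearSeries.ofScalars_apply_eq, hc, zero_add, smul_eq_mul] at h
  convert! h using 1
  rw [one_div, Complex.ofReal_neg, Complex.cpow_neg]

theorem summable_norm_binomTerm (a : ℝ) {z : ℂ} (hz : ‖z‖ < 1) :
    Summable (fun n : ℕ => ‖binomTerm a z n‖) :=
  (hasSum_one_sub_cpow_neg a hz).summable.norm

theorem lamPoly_eq_cauchy (lam : ℝ) (n : ℕ) (x y : ℂ) :
    lamPoly lam n x y =
      ∑ j ∈ Finset.range (n + 1), binomTerm lam y j * binomTerm (lam + 1) x (n - j) := by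
  unfold lamPoly binomTerm
  refine Finset.sum_congr rfl fun j _ => ?_
  rw [mul_div_mul_comm]
  push_cast
  ring

theorem summable_norm_lamPoly (lam : ℝ) {x y : ℂ} (hx : ‖x‖ < 1) (hy : ‖y‖ < 1) :
    Summable (fun n : ℕ => ‖lamPoly lam n x y‖) := by
  simp only [lamPoly_eq_cauchy]
  exact summable_norm_sum_mul_range_of_summable_norm (summable_norm_binomTerm lam hy)
    (summable_norm_binomTerm (lam + 1) hx)

/-- Generating function of the coefficients `lamPoly`. -/
theorem hasSum_lamPoly (lam : ℝ) {x y : ℂ} (hx : ‖x‖ < 1) (hy : ‖y‖ < 1) :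
    HasSum (fun n : ℕ => lamPoly lam n x y)
      ((1 - x) ^ ((-(lam + 1) : ℝ) : ℂ) * (1 - y) ^ ((-lam : ℝ) : ℂ)) := by
  rw [mul_comm, ← (hasSum_one_sub_cpow_neg lam hy).tsum_eq,
    ← (hasSum_one_sub_cpow_neg (lam + 1) hx).tsum_eq,
    tsum_mul_tsum_eq_tsum_sum_range_of_summable_norm (summable_norm_binomTerm lam hy)
    (summable_norm_binomTerm (lam + 1) hx)]
  simp only [← lamPoly_eq_cauchy]
  exact (summable_norm_lamPoly lam hx hy).of_norm.hasSum

/-! ### Integrals of products of powers -/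

section PowerIntegrals

open MeasureTheory

variable {κ : Type*} [Fintype κ]

/-- The product of powers `∏ₗ (1 - r bₗ) ^ (-sₗ)`, as a function of `r`. -/
noncomputable def powProd (b : κ → ℂ) (s : κ → ℝ) (r : ℂ) : ℂ :=
  ∏ l, (1 - r * b l) ^ ((-(s l) : ℝ) : ℂ)

theorem norm_powProd (b : κ → ℂ) (s : κ → ℝ) (r : ℂ) :
    ‖powProd b s r‖ = ∏ l, ‖1 - r * b l‖ ^ (-(s l)) := by
  simp only [powProd, norm_prod, Complex.norm_cpow_real]

theorem one_sub_mem_slitPlane {z : ℂ} (hz : ‖z‖ < 1) : 1 - z ∈ Complex.slitPlane := by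
  rw [sub_eq_add_neg]
  exact Complex.mem_slitPlane_of_norm_lt_one (by simpa using hz)

theorem one_sub_ne_zero_of_norm_lt_one {z : ℂ} (hz : ‖z‖ < 1) : 1 - z ≠ 0 :=
  Complex.slitPlane_ne_zero (one_sub_mem_slitPlane hz)

theorem norm_powProd_le {b : κ → ℂ} {s : κ → ℝ} (hs : ∀ l, 0 ≤ s l) {r : ℂ} {ρ : ℝ} (hρ : ρ < 1)
    (h : ∀ l, ‖r * b l‖ ≤ ρ) : ‖powProd b s r‖ ≤ ∏ l, (1 - ρ) ^ (-(s l)) := by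
  rw [norm_powProd]
  refine Finset.prod_le_prod (fun l _ => Real.rpow_nonneg (norm_nonneg _) _) fun l _ => ?_
  refine Real.rpow_le_rpow_of_nonpos (by linarith) ?_ (by linarith [hs l])
  have := norm_sub_norm_le (1 : ℂ) (r * b l)
  rw [norm_one] at this
  linarith [h l]

/-- The integral over `t` of the products of powers with bases `1 - r bₗ(t)`. -/
noncomputable def powInt (μ : Measure ℝ) (b : κ → ℝ → ℂ) (s : κ → ℝ) (r : ℂ) : ℂ :=
  ∫ t, powProd (fun l => b l t) s r ∂μ

theorem measurable_powProd {b : κ → ℝ → ℂ} (hb : ∀ l, Measurable (b l)) (s : κ → ℝ) (r : ℂ) :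
    Measurable fun t => powProd (fun l => b l t) s r := by
  unfold powProd
  exact Finset.measurable_fun_prod _ fun l _ =>
    (measurable_const.sub ((hb l).const_mul r)).pow_const _

section Derivatives

variable [DecidableEq κ]

theorem powProd_add_single (b : κ → ℂ) (s : κ → ℝ) {r : ℂ} (l : κ) (h : ‖r * b l‖ < 1) :
    powProd b (s + Pi.single l 1) r = (1 - r * b l)⁻¹ * powProd b s r := by
  unfold powProd
  rw [← Finset.mul_prod_erase _ _ (Finset.mem_univ l),
    ← Finset.mul_prod_erase Finset.univ (fun l => (1 - r * b l) ^ ((-(s l) : ℝ) : ℂ))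
      (Finset.mem_univ l), ← mul_assoc]
  congr 1
  · have : ((-((s + Pi.single l 1 : κ → ℝ) l) : ℝ) : ℂ) = -1 + ((-(s l) : ℝ) : ℂ) := by
      simp
    rw [this, Complex.cpow_add _ _ (one_sub_ne_zero_of_norm_lt_one h), Complex.cpow_neg_one]
  · refine Finset.prod_congr rfl fun k hk => ?_
    rw [Pi.add_apply, Pi.single_eq_of_ne (Finset.ne_of_mem_erase hk), add_zero]

theorem hasDerivAt_powProd (b : κ → ℂ) (s : κ → ℝ) {r : ℂ} (h : ∀ l, ‖r * b l‖ < 1) :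
    HasDerivAt (powProd b s) (∑ l, (s l : ℂ) * b l * powProd b (s + Pi.single l 1) r) r := by
  have h1 : ∀ l ∈ (Finset.univ : Finset κ), HasDerivAt
      (fun r : ℂ => (1 - r * b l) ^ ((-(s l) : ℝ) : ℂ))
      ((s l : ℂ) * b l * ((1 - r * b l)⁻¹ * (1 - r * b l) ^ ((-(s l) : ℝ) : ℂ))) r := by
    intro l _
    have h2 : HasDerivAt (fun r : ℂ => 1 - r * b l) (-(1 * b l)) r :=
      ((hasDerivAt_id r).mul_const (b l)).const_sub 1
    convert! h2.cpow_const (c := ((-(s l) : ℝ) : ℂ)) (one_sub_mem_slitPlane (h l)) using 1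
    rw [sub_eq_neg_add _ (1 : ℂ), Complex.cpow_add _ _ (one_sub_ne_zero_of_norm_lt_one (h l)),
      Complex.cpow_neg_one]
    push_cast
    ring
  convert! HasDerivAt.fun_finsetProd h1 using 1
  refine Finset.sum_congr rfl fun l _ => ?_
  rw [powProd_add_single b s l (h l), powProd, ← Finset.mul_prod_erase _ _ (Finset.mem_univ l),
    smul_eq_mul]
  ring

/-- The Euler operator `r d/dr` only shifts the exponents of a product of powers. -/
theorem euler_powProd (b : κ → ℂ) (s : κ → ℝ) {r : ℂ} (h : ∀ l, ‖r * b l‖ < 1) :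
    r * ∑ l, (s l : ℂ) * b l * powProd b (s + Pi.single l 1) r =
      ∑ l, (s l : ℂ) * (powProd b (s + Pi.single l 1) r - powProd b s r) := by
  rw [Finset.mul_sum]
  refine Finset.sum_congr rfl fun l _ => ?_
  rw [powProd_add_single b s l (h l)]
  have := one_sub_ne_zero_of_norm_lt_one (h l)
  field_simp
  ring

end Derivatives

variable {μ : Measure ℝ} [IsFiniteMeasure μ] {b : κ → ℝ → ℂ} {ρ : ℝ}

theorem norm_mul_le_of_mem_ball {z c : ℂ} (hz : z ∈ Metric.ball (0 : ℂ) 1) (hc : ‖c‖ ≤ ρ) :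
    ‖z * c‖ ≤ ρ := by
  rw [norm_mul]
  have h0 := norm_nonneg c
  have : ‖z‖ < 1 := by simpa using hz
  nlinarith

theorem integrable_powProd (hb : ∀ l, Measurable (b l)) (hρ : ρ < 1)
    (hbρ : ∀ᵐ t ∂μ, ∀ l, ‖b l t‖ ≤ ρ) {s : κ → ℝ} (hs : ∀ l, 0 ≤ s l) {r : ℂ}
    (hr : r ∈ Metric.ball (0 : ℂ) 1) : Integrable (fun t => powProd (fun l => b l t) s r) μ := by
  refine Integrable.of_bound (measurable_powProd hb s r).aestronglyMeasurable
    (∏ l, (1 - ρ) ^ (-(s l))) ?_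
  filter_upwards [hbρ] with t ht
  exact norm_powProd_le hs hρ fun l => norm_mul_le_of_mem_ball hr (ht l)

theorem add_single_nonneg {ι : Type*} [DecidableEq ι] {s : ι → ℝ} (hs : ∀ l, 0 ≤ s l) (l k : ι) :
    0 ≤ (s + Pi.single l 1 : ι → ℝ) k :=
  add_nonneg (hs k) (by by_cases h : k = l <;> simp [h])

variable [DecidableEq κ]

theorem hasDerivAt_powInt (hb : ∀ l, Measurable (b l)) (hρ : ρ < 1)
    (hbρ : ∀ᵐ t ∂μ, ∀ l, ‖b l t‖ ≤ ρ) {s : κ → ℝ} (hs : ∀ l, 0 ≤ s l) {r : ℂ}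
    (hr : r ∈ Metric.ball (0 : ℂ) 1) :
    HasDerivAt (powInt μ b s)
      (∫ t, ∑ l, (s l : ℂ) * b l t * powProd (fun l => b l t) (s + Pi.single l 1) r ∂μ) r := by
  let B : κ → ℝ := fun l => s l * ρ * ∏ k, (1 - ρ) ^ (-((s + Pi.single l 1 : κ → ℝ) k))
  have h1 : ∀ᵐ t ∂μ, ∀ z ∈ Metric.ball (0 : ℂ) 1, HasDerivAt (powProd (fun l => b l t) s)
      (∑ l, (s l : ℂ) * b l t * powProd (fun l => b l t) (s + Pi.single l 1) z) z := by
    filter_upwards [hbρ] with t ht z hz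
    exact hasDerivAt_powProd _ s fun l => (norm_mul_le_of_mem_ball hz (ht l)).trans_lt hρ
  have h2 : ∀ᵐ t ∂μ, ∀ z ∈ Metric.ball (0 : ℂ) 1,
      ‖∑ l, (s l : ℂ) * b l t * powProd (fun l => b l t) (s + Pi.single l 1) z‖ ≤ ∑ l, B l := by
    filter_upwards [hbρ] with t ht z hz
    refine (norm_sum_le _ _).trans (Finset.sum_le_sum fun l _ => ?_)
    rw [norm_mul, norm_mul, Complex.norm_real, Real.norm_of_nonneg (hs l)]
    have h1 := norm_powProd_le (b := fun l => b l t) (add_single_nonneg hs l) hρ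
      fun k => norm_mul_le_of_mem_ball hz (ht k)
    have h2 := (norm_nonneg _).trans (ht l)
    exact mul_le_mul (mul_le_mul_of_nonneg_left (ht l) (hs l)) h1 (norm_nonneg _)
      (mul_nonneg (hs l) h2)
  have h3 : Measurable fun t =>
      ∑ l, (s l : ℂ) * b l t * powProd (fun l => b l t) (s + Pi.single l 1) r :=
    Finset.measurable_fun_sum _ fun l _ =>
      ((hb l).const_mul _).mul (measurable_powProd hb _ r)
  exact (hasDerivAt_integral_of_dominated_loc_of_deriv_le (Metric.isOpen_ball.mem_nhds hr)
    (Filter.Eventually.of_forall fun r => (measurable_powProd hb s r).aestronglyMeasurable)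
    (integrable_powProd hb hρ hbρ hs hr) h3.aestronglyMeasurable h2 (integrable_const _) h1).2

theorem differentiableOn_powInt (hb : ∀ l, Measurable (b l)) (hρ : ρ < 1)
    (hbρ : ∀ᵐ t ∂μ, ∀ l, ‖b l t‖ ≤ ρ) {s : κ → ℝ} (hs : ∀ l, 0 ≤ s l) :
    DifferentiableOn ℂ (powInt μ b s) (Metric.ball 0 1) := fun _ hr =>
  (hasDerivAt_powInt hb hρ hbρ hs hr).differentiableAt.differentiableWithinAt

/-- The Euler operator acts on the integrals `powInt` by shifting the exponents. -/
theorem euler_powInt (hb : ∀ l, Measurable (b l)) (hρ : ρ < 1)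
    (hbρ : ∀ᵐ t ∂μ, ∀ l, ‖b l t‖ ≤ ρ) {s : κ → ℝ} (hs : ∀ l, 0 ≤ s l) {r : ℂ}
    (hr : r ∈ Metric.ball (0 : ℂ) 1) :
    r * deriv (powInt μ b s) r =
      ∑ l, (s l : ℂ) * (powInt μ b (s + Pi.single l 1) r - powInt μ b s r) := by
  rw [(hasDerivAt_powInt hb hρ hbρ hs hr).deriv, ← integral_const_mul]
  have h1 : ∀ l, Integrable (fun t => (s l : ℂ) *
      (powProd (fun l => b l t) (s + Pi.single l 1) r - powProd (fun l => b l t) s r)) μ :=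
    fun l => ((integrable_powProd hb hρ hbρ (add_single_nonneg hs l) hr).sub
      (integrable_powProd hb hρ hbρ hs hr)).const_mul _
  calc _ = ∫ t, ∑ l, (s l : ℂ) *
      (powProd (fun l => b l t) (s + Pi.single l 1) r - powProd (fun l => b l t) s r) ∂μ := by
        refine integral_congr_ae ?_
        filter_upwards [hbρ] with t ht
        exact euler_powProd _ s fun l => (norm_mul_le_of_mem_ball hr (ht l)).trans_lt hρ
    _ = _ := by
        rw [integral_finsetSum _ fun l _ => h1 l]
        refine Finset.sum_congr rfl fun l _ => ?_
        rw [integral_const_mul,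
          integral_sub (integrable_powProd hb hρ hbρ (add_single_nonneg hs l) hr)
            (integrable_powProd hb hρ hbρ hs hr)]
        rfl

end PowerIntegrals

/-! ### Iterates of the Euler operator -/

open MeasureTheory in
/-- The iterates of `r d/dr` on `powInt μ b s` are linear combinations of integrals of the same
kind with shifted exponents. The coefficients depend on the exponents `s` and on the number `m` of
iterations, but neither on the measure nor on the bases. -/
theorem exists_eulerOp_iterate_powInt {κ : Type} [Fintype κ] [DecidableEq κ] (s : κ → ℝ)
    (hs : ∀ l, 0 ≤ s l) (m : ℕ) :
    ∃ (ι : Type) (_ : Fintype ι) (c : ι → ℝ) (x : ι → κ → ℕ), (∀ i, ∑ l, x i l ≤ m) ∧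
      ∀ (μ : Measure ℝ) [IsFiniteMeasure μ] (b : κ → ℝ → ℂ) (ρ : ℝ), (∀ l, Measurable (b l)) →
        ρ < 1 → (∀ᵐ t ∂μ, ∀ l, ‖b l t‖ ≤ ρ) → ∀ r ∈ Set.Ioo (-1 : ℝ) 1,
          (eulerOp^[m] fun r : ℝ => powInt μ b s r) r =
            ∑ i, (c i : ℂ) * powInt μ b (s + fun l => (x i l : ℝ)) r := by
  induction m with
  | zero =>
    refine ⟨Unit, inferInstance, fun _ => 1, fun _ _ => 0, by simp, ?_⟩
    intro μ _ b ρ _ _ _ r _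
    simp only [Function.iterate_zero, id_eq, Finset.univ_unique, Finset.sum_singleton,
      Complex.ofReal_one, one_mul, Nat.cast_zero]
    congr 1
    exact (add_zero s).symm
  | succ m ih =>
    obtain ⟨ι, hι, c, x, hx, h⟩ := ih
    -- The Boolean separates the two summands of `sₗ (I (s + eₗ) - I s)` in `euler_powInt`.
    refine ⟨ι × κ × Bool, inferInstance,
      fun p => if p.2.2 then c p.1 * (s p.2.1 + x p.1 p.2.1)
        else -(c p.1 * (s p.2.1 + x p.1 p.2.1)),
      fun p => if p.2.2 then x p.1 + Pi.single p.2.1 1 else x p.1, ?_, ?_⟩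
    · rintro ⟨i, l, _ | _⟩
      · simpa using (hx i).trans (Nat.le_succ m)
      · simpa [Finset.sum_add_distrib] using hx i
    · intro μ _ b ρ hb hρ hbρ r hr
      have hball : ∀ r ∈ Set.Ioo (-1 : ℝ) 1, (r : ℂ) ∈ Metric.ball (0 : ℂ) 1 := fun r hr => by
        simpa [abs_lt] using hr
      have hsx : ∀ i l, 0 ≤ (s + fun l => (x i l : ℝ)) l := fun i l =>
        add_nonneg (hs l) (Nat.cast_nonneg _)
      have hd : HasDerivAt
          (fun r : ℝ => ∑ i, (c i : ℂ) * powInt μ b (s + fun l => (x i l : ℝ)) r)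
          (∑ i, (c i : ℂ) * deriv (powInt μ b (s + fun l => (x i l : ℝ))) r) r := by
        refine HasDerivAt.fun_sum fun i _ => HasDerivAt.const_mul _ ?_
        exact (hasDerivAt_powInt hb hρ hbρ (hsx i)
          (hball r hr)).differentiableAt.hasDerivAt.comp_ofReal
      rw [Function.iterate_succ_apply']
      have he : (eulerOp^[m] fun r : ℝ => powInt μ b s r) =ᶠ[nhds r]
          fun r : ℝ => ∑ i, (c i : ℂ) * powInt μ b (s + fun l => (x i l : ℝ)) r := by
        filter_upwards [isOpen_Ioo.mem_nhds hr] with y hy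
        exact h μ b ρ hb hρ hbρ y hy
      rw [eulerOp, he.deriv_eq, hd.deriv, Finset.mul_sum, Fintype.sum_prod_type]
      refine Finset.sum_congr rfl fun i _ => ?_
      rw [mul_left_comm, euler_powInt hb hρ hbρ (hsx i) (hball r hr), Finset.mul_sum,
        Fintype.sum_prod_type]
      refine Finset.sum_congr rfl fun l _ => ?_
      have hshift : (s + fun k => (((x i + Pi.single l 1 : κ → ℕ) k : ℕ) : ℝ)) =
          (s + fun k => (x i k : ℝ)) + Pi.single l 1 := by
        ext k
        by_cases hk : k = l
        · subst hk; simp [add_assoc]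
        · simp [hk]
      simp only [Fintype.sum_bool, if_true, Bool.false_eq_true, if_false, hshift]
      simp only [Pi.add_apply]
      push_cast
      ring

/-! ### The beta distribution -/

section BetaDistribution

open MeasureTheory ProbabilityTheory Set

variable {a b : ℝ}

theorem betaPDFReal_nonneg (ha : 0 < a) (hb : 0 < b) (t : ℝ) : 0 ≤ betaPDFReal a b t := by
  by_cases h : 0 < t ∧ t < 1
  · exact (betaPDFReal_pos h.1 h.2 ha hb).le
  · rw [betaPDFReal, if_neg h]

theorem measurable_betaPDF (a b : ℝ) : Measurable (betaPDF a b) :=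
  (measurable_betaPDFReal a b).ennreal_ofReal

/-- Integration against the beta distribution, written with its density on `(0, 1)`. -/
theorem integral_betaMeasure {E : Type*} [NormedAddCommGroup E] [NormedSpace ℝ E] (ha : 0 < a)
    (hb : 0 < b) (f : ℝ → E) :
    ∫ t, f t ∂(betaMeasure a b) =
      ∫ t in Ioo 0 1, (1 / beta a b * t ^ (a - 1) * (1 - t) ^ (b - 1)) • f t := by
  rw [betaMeasure, integral_withDensity_eq_integral_toReal_smul (measurable_betaPDF a b)
    (Filter.Eventually.of_forall fun _ => ENNReal.ofReal_lt_top),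
    ← integral_indicator measurableSet_Ioo]
  refine integral_congr_ae (Filter.Eventually.of_forall fun t => ?_)
  simp only [betaPDF, ENNReal.toReal_ofReal (betaPDFReal_nonneg ha hb t)]
  by_cases h : t ∈ Ioo (0 : ℝ) 1
  · rw [indicator_of_mem h, betaPDFReal, if_pos (mem_Ioo.mp h)]
  · rw [indicator_of_notMem h, betaPDFReal, if_neg (show ¬(0 < t ∧ t < 1) from h), zero_smul]

theorem ae_mem_Ioo_betaMeasure (a b : ℝ) : ∀ᵐ t ∂(betaMeasure a b), t ∈ Ioo (0 : ℝ) 1 := by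
  rw [betaMeasure, ae_withDensity_iff (measurable_betaPDF a b)]
  refine Filter.Eventually.of_forall fun t ht => ?_
  by_contra h
  exact ht (by rw [betaPDF_eq, if_neg (show ¬(0 < t ∧ t < 1) from h), ENNReal.ofReal_zero])

theorem integrableOn_betaDensity_smul {E : Type*} [NormedAddCommGroup E] [NormedSpace ℝ E]
    (ha : 0 < a) (hb : 0 < b) {f : ℝ → E} (hf : Integrable f (betaMeasure a b)) :
    IntegrableOn (fun t => (1 / beta a b * t ^ (a - 1) * (1 - t) ^ (b - 1)) • f t) (Ioo 0 1) := by
  rw [betaMeasure, integrable_withDensity_iff_integrable_smul' (measurable_betaPDF a b)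
    (Filter.Eventually.of_forall fun _ => ENNReal.ofReal_lt_top)] at hf
  refine (hf.integrableOn (s := Ioo 0 1)).congr_fun (fun t ht => ?_) measurableSet_Ioo
  simp only [betaPDF, ENNReal.toReal_ofReal (betaPDFReal_nonneg ha hb t)]
  rw [betaPDFReal, if_pos (mem_Ioo.mp ht)]

theorem Gamma_add_nat_eq_ascPochhammer (ha : 0 < a) (n : ℕ) :
    Real.Gamma (a + n) = (ascPochhammer ℝ n).eval a * Real.Gamma a := by
  induction n with
  | zero => simp
  | succ n ih =>
    rw [Nat.cast_succ, ← add_assoc, Real.Gamma_add_one (by positivity), ih,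
      ascPochhammer_succ_eval]
    ring

/-- The beta integral, read off from the normalisation of the beta distribution. -/
theorem setIntegral_Ioo_eq_beta (ha : 0 < a) (hb : 0 < b) :
    ∫ t in Ioo (0 : ℝ) 1, t ^ (a - 1) * (1 - t) ^ (b - 1) = beta a b := by
  have h := integral_betaMeasure ha hb fun _ => (1 : ℝ)
  have := isProbabilityMeasureBeta ha hb
  simp only [integral_const, probReal_univ, smul_eq_mul, mul_one, mul_assoc] at h
  rw [integral_const_mul] at h
  have := (beta_pos ha hb).ne'
  field_simp at h
  exact h.symm

/-- The mixed moments of the beta distribution. -/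
theorem integral_pow_mul_pow_betaMeasure (ha : 0 < a) (hb : 0 < b) (i j : ℕ) :
    ∫ t, t ^ i * (1 - t) ^ j ∂(betaMeasure a b) =
      (ascPochhammer ℝ i).eval a * (ascPochhammer ℝ j).eval b /
        (ascPochhammer ℝ (i + j)).eval (a + b) := by
  rw [integral_betaMeasure ha hb]
  have h : ∀ t ∈ Ioo (0 : ℝ) 1, (1 / beta a b * t ^ (a - 1) * (1 - t) ^ (b - 1)) •
      (t ^ i * (1 - t) ^ j) =
      1 / beta a b * (t ^ (a + i - 1) * (1 - t) ^ (b + j - 1)) := by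
    intro t ht
    rw [show a + i - 1 = a - 1 + i by ring, show b + j - 1 = b - 1 + j by ring,
      Real.rpow_add ht.1, Real.rpow_add (by linarith [ht.2]), Real.rpow_natCast,
      Real.rpow_natCast, smul_eq_mul]
    ring
  rw [setIntegral_congr_fun measurableSet_Ioo h, integral_const_mul,
    setIntegral_Ioo_eq_beta (by positivity) (by positivity), beta, beta,
    show a + i + (b + j) = a + b + (i + j : ℕ) by push_cast; ring,
    Gamma_add_nat_eq_ascPochhammer ha, Gamma_add_nat_eq_ascPochhammer hb,
    Gamma_add_nat_eq_ascPochhammer (add_pos ha hb)]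
  have h1 := (Real.Gamma_pos_of_pos ha).ne'
  have h2 := (Real.Gamma_pos_of_pos hb).ne'
  have h3 := (Real.Gamma_pos_of_pos (add_pos ha hb)).ne'
  have h4 := (ascPochhammer_pos (i + j) (a + b) (add_pos ha hb)).ne'
  field_simp

/-- Up to normalisation, the polynomials `lamPoly` are the moments of a beta distribution on the
segment from `y` to `x`. -/
theorem integral_segment_pow_betaMeasure {lam : ℝ} (hlam : 0 < lam) (n : ℕ) (x y : ℂ) :
    ∫ t : ℝ, ((t : ℂ) * x + (1 - t) * y) ^ n ∂(betaMeasure (lam + 1) lam) =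
      (((Nat.factorial n : ℝ) / (ascPochhammer ℝ n).eval (2 * lam + 1) : ℝ) : ℂ) *
        lamPoly lam n x y := by
  have hl1 : 0 < lam + 1 := by positivity
  have := isProbabilityMeasureBeta hl1 hlam
  have h1 : ∀ t : ℝ, ((t : ℂ) * x + (1 - t) * y) ^ n = ∑ j ∈ Finset.range (n + 1),
      ((t ^ (n - j) * (1 - t) ^ j : ℝ) : ℂ) * (x ^ (n - j) * y ^ j * n.choose j) := by
    intro t
    rw [add_comm, add_pow]
    refine Finset.sum_congr rfl fun j _ => ?_
    push_cast
    rw [mul_pow, mul_pow]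
    ring
  have hint : ∀ i j : ℕ, Integrable (fun t : ℝ => ((t ^ i * (1 - t) ^ j : ℝ) : ℂ))
      (betaMeasure (lam + 1) lam) := by
    intro i j
    refine Integrable.of_bound (by fun_prop) 1 ?_
    filter_upwards [ae_mem_Ioo_betaMeasure (lam + 1) lam] with t ht
    have h0 : 0 ≤ 1 - t := by linarith [ht.2]
    rw [Complex.norm_real, Real.norm_of_nonneg (mul_nonneg (pow_nonneg ht.1.le _)
      (pow_nonneg h0 _))]
    exact mul_le_one₀ (pow_le_one₀ ht.1.le ht.2.le) (pow_nonneg h0 _)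
      (pow_le_one₀ h0 (by linarith [ht.1]))
  simp only [h1]
  rw [integral_finsetSum _ fun j _ => (hint _ _).mul_const _, lamPoly, Finset.mul_sum]
  refine Finset.sum_congr rfl fun j hj => ?_
  have hjn : j ≤ n := Nat.lt_succ_iff.mp (Finset.mem_range.mp hj)
  rw [integral_mul_const, integral_complex_ofReal, integral_pow_mul_pow_betaMeasure hl1 hlam,
    Nat.sub_add_cancel hjn, Nat.cast_choose ℂ hjn, show lam + 1 + lam = 2 * lam + 1 by ring]
  have h4 : (((ascPochhammer ℝ n).eval (2 * lam + 1) : ℝ) : ℂ) ≠ 0 := by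
    exact_mod_cast (ascPochhammer_pos n (2 * lam + 1) (by positivity)).ne'
  have h5 : ((Nat.factorial j : ℕ) : ℂ) ≠ 0 := by exact_mod_cast Nat.factorial_ne_zero j
  have h6 : ((Nat.factorial (n - j) : ℕ) : ℂ) ≠ 0 := by exact_mod_cast Nat.factorial_ne_zero _
  push_cast
  field_simp

end BetaDistribution

/-! ### Powers of convex combinations under the beta distribution -/

section BetaEstimates

open MeasureTheory ProbabilityTheory Set

/-- Dropping the summand `(1 - t) A²` leaves `t ^ (-lam)`, which is integrable because the density
contains the factor `t ^ lam`. -/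
theorem integral_rpow_convexCombo_le {lam : ℝ} (hlam : 0 < lam) :
    ∃ C : ℝ, 0 ≤ C ∧ ∀ A B : ℝ, 0 < A → 0 < B →
      ∫ t, ((1 - t) * A ^ 2 + t * B ^ 2) ^ (-lam) ∂(betaMeasure (lam + 1) lam) ≤
        C * B ^ (-2 * lam) := by
  have hl1 : 0 < lam + 1 := by positivity
  have hβ := beta_pos hl1 hlam
  have hβ1 := beta_pos one_pos hlam
  refine ⟨1 / beta (lam + 1) lam * beta 1 lam, by positivity, fun A B hA hB => ?_⟩
  rw [integral_betaMeasure hl1 hlam]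
  have hI := setIntegral_Ioo_eq_beta one_pos hlam
  have hint : IntegrableOn (fun t : ℝ => t ^ ((1 : ℝ) - 1) * (1 - t) ^ (lam - 1)) (Ioo 0 1) :=
    Integrable.of_integral_ne_zero (by rw [hI]; exact hβ1.ne')
  have hle : ∀ t ∈ Ioo (0 : ℝ) 1, ((1 - t) * A ^ 2 + t * B ^ 2) ^ (-lam) ≤
      t ^ (-lam) * B ^ (-2 * lam) := by
    intro t ht
    have h1 : 0 < 1 - t := by linarith [ht.2]
    have h2 : B ^ (-2 * lam) = (B ^ 2) ^ (-lam) := by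
      rw [← Real.rpow_natCast B 2, ← Real.rpow_mul hB.le]
      norm_num
    rw [h2, ← Real.mul_rpow ht.1.le (by positivity)]
    have := ht.1
    exact Real.rpow_le_rpow_of_nonpos (by positivity) (by linarith [mul_pos h1 (pow_pos hA 2)])
      (by linarith)
  calc _ ≤ ∫ t in Ioo (0 : ℝ) 1, 1 / beta (lam + 1) lam * B ^ (-2 * lam) *
        (t ^ ((1 : ℝ) - 1) * (1 - t) ^ (lam - 1)) := by
        refine integral_mono_of_nonneg ?_ (hint.const_mul _) ?_
        · refine (ae_restrict_iff' measurableSet_Ioo).2 (Filter.Eventually.of_forall fun t ht => ?_)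
          have h1 : 0 < 1 - t := by linarith [ht.2]
          have := ht.1
          simp only [Pi.zero_apply, smul_eq_mul]
          positivity
        · refine (ae_restrict_iff' measurableSet_Ioo).2 (Filter.Eventually.of_forall fun t ht => ?_)
          have h1 : 0 < 1 - t := by linarith [ht.2]
          have h0 := ht.1
          simp only [smul_eq_mul, sub_self, Real.rpow_zero, one_mul, add_sub_cancel_right]
          calc _ ≤ 1 / beta (lam + 1) lam * t ^ lam * (1 - t) ^ (lam - 1) *
                (t ^ (-lam) * B ^ (-2 * lam)) :=
                mul_le_mul_of_nonneg_left (hle t ht) (by positivity)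
            _ = _ := by
                rw [Real.rpow_neg h0.le]
                have := (Real.rpow_pos_of_pos h0 lam).ne'
                field_simp
    _ = _ := by rw [integral_const_mul, hI]; ring

/-- The primitive that makes the integral of `u ^ (lam - 1) * (√u * A + B) ^ (-2 * lam - 1)`
explicit. -/
theorem hasDerivAt_rpow_mul_sqrt_rpow {lam A B u : ℝ} (hA : 0 < A) (hB : 0 < B) (hu : 0 < u) :
    HasDerivAt (fun u : ℝ => u ^ lam * (√u * A + B) ^ (-2 * lam))
      (lam * B * (u ^ (lam - 1) * (√u * A + B) ^ (-2 * lam - 1))) u := by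
  have hs := Real.sqrt_pos.mpr hu
  have hX : 0 < √u * A + B := by positivity
  have h1 : HasDerivAt (fun u : ℝ => u ^ lam) (lam * u ^ (lam - 1)) u :=
    Real.hasDerivAt_rpow_const (Or.inl hu.ne')
  have h2 : HasDerivAt (fun u : ℝ => √u * A + B) (1 / (2 * √u) * A) u :=
    ((Real.hasDerivAt_sqrt hu.ne').mul_const A).add_const B
  have h3 := h2.rpow_const (p := -2 * lam) (Or.inl hX.ne')
  convert! h1.mul h3 using 1
  have h4 : u ^ lam = u ^ (lam - 1) * (√u * √u) := by
    rw [Real.mul_self_sqrt hu.le]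
    nth_rewrite 3 [← Real.rpow_one u]
    rw [← Real.rpow_add hu, sub_add_cancel]
  have h5 : (√u * A + B) ^ (-2 * lam) = (√u * A + B) ^ (-2 * lam - 1) * (√u * A + B) := by
    nth_rewrite 3 [← Real.rpow_one (√u * A + B)]
    rw [← Real.rpow_add hX, sub_add_cancel]
  rw [h4, h5]
  field_simp
  ring

/-- The extra exponent `-1 / 2` makes the integral concentrate where `1 - t` is at most of order
`(B / A)²`, so that no factor `log (A / B)` appears. -/
theorem integral_rpow_convexCombo_sub_half_le {lam : ℝ} (hlam : 0 < lam) :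
    ∃ C : ℝ, 0 ≤ C ∧ ∀ A B : ℝ, 0 < A → 0 < B → B ≤ A →
      ∫ t, ((1 - t) * A ^ 2 + t * B ^ 2) ^ (-lam - 1 / 2) ∂(betaMeasure (lam + 1) lam) ≤
        C * (A ^ (-2 * lam) / B) := by
  have hl1 : 0 < lam + 1 := by positivity
  have hβ := beta_pos hl1 hlam
  refine ⟨1 / beta (lam + 1) lam * 2 ^ (2 * lam + 1) / lam, by positivity,
    fun A B hA hB hBA => ?_⟩
  rw [integral_betaMeasure hl1 hlam]
  set g : ℝ → ℝ := fun t =>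
    -(lam * B)⁻¹ * ((1 - t) ^ lam * (√(1 - t) * A + B) ^ (-2 * lam)) with hg
  set g' : ℝ → ℝ := fun t => (1 - t) ^ (lam - 1) * (√(1 - t) * A + B) ^ (-2 * lam - 1) with hg'
  have hgc : ContinuousOn g (Icc 0 1) := by
    refine continuousOn_const.mul (ContinuousOn.mul ?_ ?_)
    · exact (continuousOn_const.sub continuousOn_id).rpow_const fun _ _ => Or.inr hlam.le
    · refine ContinuousOn.rpow_const (by fun_prop) fun t _ => Or.inl ?_
      positivity
  have hgd : ∀ t ∈ Ioo (0 : ℝ) 1, HasDerivAt g (g' t) t := by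
    intro t ht
    have h1 : 0 < 1 - t := by linarith [ht.2]
    have h2 := (hasDerivAt_rpow_mul_sqrt_rpow (lam := lam) hA hB h1).comp t
      ((hasDerivAt_id t).const_sub 1)
    convert! h2.const_mul (-(lam * B)⁻¹) using 1
    simp only [hg']
    field_simp
  have hg'pos : ∀ t ∈ Ioo (0 : ℝ) 1, 0 ≤ g' t := by
    intro t ht
    have h1 : 0 < 1 - t := by linarith [ht.2]
    positivity
  have hint := intervalIntegral.integrableOn_deriv_of_nonneg hgc hgd hg'pos
  have hFTC := intervalIntegral.integral_eq_sub_of_hasDerivAt_of_le zero_le_one hgc hgd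
    ((intervalIntegrable_iff_integrableOn_Ioc_of_le zero_le_one).2 hint)
  rw [intervalIntegral.integral_of_le zero_le_one, integral_Ioc_eq_integral_Ioo] at hFTC
  have hval : g 1 - g 0 = (lam * B)⁻¹ * (A + B) ^ (-2 * lam) := by
    simp [hg, Real.zero_rpow hlam.ne']
  -- `F` dominates both `(1 - t) A²` and `B²`, hence `4 F ≥ (√(1 - t) A + B)²`.
  have hle : ∀ t ∈ Ioo (0 : ℝ) 1, ((1 - t) * A ^ 2 + t * B ^ 2) ^ (-lam - 1 / 2) ≤
      2 ^ (2 * lam + 1) * (√(1 - t) * A + B) ^ (-2 * lam - 1) := by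
    intro t ht
    have h1 : 0 < 1 - t := by linarith [ht.2]
    have h0 := ht.1
    have hs := Real.sqrt_pos.mpr h1
    have hX : 0 < √(1 - t) * A + B := by positivity
    have hF : ((√(1 - t) * A + B) / 2) ^ 2 ≤ (1 - t) * A ^ 2 + t * B ^ 2 := by
      have h3 : √(1 - t) ^ 2 = 1 - t := Real.sq_sqrt h1.le
      have h4 : B ^ 2 ≤ A ^ 2 := by gcongr
      nlinarith [sq_nonneg (√(1 - t) * A - B), mul_nonneg h1.le (sub_nonneg.2 h4)]
    calc _ ≤ (((√(1 - t) * A + B) / 2) ^ 2) ^ (-lam - 1 / 2) :=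
          Real.rpow_le_rpow_of_nonpos (by positivity) hF (by linarith)
      _ = ((√(1 - t) * A + B) / 2) ^ (-2 * lam - 1) := by
          rw [← Real.rpow_natCast _ 2, ← Real.rpow_mul (by positivity)]
          congr 1
          push_cast
          ring
      _ = _ := by
          rw [Real.div_rpow hX.le zero_le_two, show 2 * lam + 1 = -(-2 * lam - 1) by ring,
            Real.rpow_neg zero_le_two]
          field_simp
  calc _ ≤ ∫ t in Ioo (0 : ℝ) 1, 1 / beta (lam + 1) lam * 2 ^ (2 * lam + 1) * g' t := by
        refine integral_mono_of_nonneg ?_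
          ((hint.mono_set Ioo_subset_Ioc_self).const_mul _) ?_
        · refine (ae_restrict_iff' measurableSet_Ioo).2 (Filter.Eventually.of_forall fun t ht => ?_)
          have h1 : 0 < 1 - t := by linarith [ht.2]
          have := ht.1
          simp only [Pi.zero_apply, smul_eq_mul]
          positivity
        · refine (ae_restrict_iff' measurableSet_Ioo).2 (Filter.Eventually.of_forall fun t ht => ?_)
          have h1 : 0 < 1 - t := by linarith [ht.2]
          have h0 := ht.1
          have h2 : t ^ lam ≤ 1 := Real.rpow_le_one h0.le ht.2.le hlam.le
          simp only [smul_eq_mul, add_sub_cancel_right, hg']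
          calc _ ≤ 1 / beta (lam + 1) lam * 1 * (1 - t) ^ (lam - 1) *
                (2 ^ (2 * lam + 1) * (√(1 - t) * A + B) ^ (-2 * lam - 1)) := by
                have := hle t ht
                gcongr
            _ = _ := by ring
    _ = 1 / beta (lam + 1) lam * 2 ^ (2 * lam + 1) * ((lam * B)⁻¹ * (A + B) ^ (-2 * lam)) := by
        rw [integral_const_mul, hFTC, hval]
    _ ≤ 1 / beta (lam + 1) lam * 2 ^ (2 * lam + 1) * ((lam * B)⁻¹ * A ^ (-2 * lam)) := by
        have := Real.rpow_le_rpow_of_nonpos hA (show A ≤ A + B by linarith)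
          (show -2 * lam ≤ 0 by linarith)
        gcongr
    _ = _ := by field_simp

end BetaEstimates

/-! ### Moving the path of integration -/

section Flow

open MeasureTheory ProbabilityTheory Set

theorem mul_cpow_of_re_pos {x y : ℂ} (hx : 0 < x.re) (hy : 0 < y.re) (c : ℂ) :
    (x * y) ^ c = x ^ c * y ^ c := by
  have hx0 : x ≠ 0 := fun h => by simp [h] at hx
  have hy0 : y ≠ 0 := fun h => by simp [h] at hy
  have h1 := abs_lt.1 (Complex.abs_arg_lt_pi_div_two_iff.2 (Or.inl hx))
  have h2 := abs_lt.1 (Complex.abs_arg_lt_pi_div_two_iff.2 (Or.inl hy))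
  rw [Complex.cpow_def_of_ne_zero (mul_ne_zero hx0 hy0), Complex.cpow_def_of_ne_zero hx0,
    Complex.cpow_def_of_ne_zero hy0,
    (Complex.log_mul_eq_add_log_iff hx0 hy0).2 ⟨by linarith, by linarith⟩, add_mul,
    Complex.exp_add]

theorem re_pos_of_mem_ball_one {x : ℂ} {ε : ℝ} (hε : ε ≤ 1) (hx : x ∈ Metric.ball (1 : ℂ) ε) :
    0 < x.re := by
  rw [mem_ball_iff_norm] at hx
  have h := Complex.abs_re_le_norm (x - 1)
  rw [Complex.sub_re, Complex.one_re] at h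
  linarith [(abs_le.1 h).1]

theorem segment_mem_ball {x y c : ℂ} {ε t : ℝ} (hx : x ∈ Metric.ball c ε)
    (hy : y ∈ Metric.ball c ε) (ht : t ∈ Icc (0 : ℝ) 1) :
    (1 - t) * x + t * y ∈ Metric.ball c ε := by
  have := (convex_ball c ε) hx hy (sub_nonneg.2 ht.2) ht.1 (sub_add_cancel 1 t)
  simpa using! this

theorem half_le_norm {x : ℂ} (hx : x ∈ Metric.ball (1 : ℂ) (1 / 2)) : 1 / 2 ≤ ‖x‖ := by
  rw [mem_ball_iff_norm'] at hx
  have := norm_sub_norm_le (1 : ℂ) x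
  rw [norm_one] at this
  linarith

theorem norm_le_two {x : ℂ} (hx : x ∈ Metric.ball (1 : ℂ) (1 / 2)) : ‖x‖ ≤ 2 := by
  rw [mem_ball_iff_norm] at hx
  have := norm_le_norm_add_norm_sub' x 1
  rw [norm_one] at this
  linarith

theorem norm_inv_le_two {x : ℂ} (hx : x ∈ Metric.ball (1 : ℂ) (1 / 2)) : ‖x⁻¹‖ ≤ 2 := by
  rw [norm_inv, inv_le_comm₀ (by linarith [half_le_norm hx]) two_pos]
  linarith [half_le_norm hx]

theorem norm_cpow_le_two_rpow {x : ℂ} (hx : x ∈ Metric.ball (1 : ℂ) (1 / 2)) (c : ℝ) :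
    ‖x ^ (c : ℂ)‖ ≤ 2 ^ |c| := by
  rw [Complex.norm_cpow_real]
  have h1 := half_le_norm hx
  have h2 := norm_le_two hx
  rcases le_total 0 c with hc | hc
  · rw [abs_of_nonneg hc]
    exact Real.rpow_le_rpow (norm_nonneg _) h2 hc
  · rw [abs_of_nonpos hc]
    calc ‖x‖ ^ c ≤ (1 / 2) ^ c := Real.rpow_le_rpow_of_nonpos (by norm_num) h1 hc
      _ = 2 ^ (-c) := by rw [one_div, Real.inv_rpow zero_le_two, Real.rpow_neg zero_le_two]

variable {lam : ℝ} {A B P Q : ℂ}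

/-- The density, with respect to the beta distribution, of the pull-back of the form
`((1 - s) A + s B) ^ (-λ) ((1 - s) P + s Q) ^ (-λ-1) s ^ λ (1 - s) ^ (λ - 1) ds` under the Möbius
map `s = t e / (1 - t + t e)` of the unit interval. -/
noncomputable def flowKernel (lam : ℝ) (A B P Q e : ℂ) (t : ℝ) : ℂ :=
  e ^ ((lam + 1 : ℝ) : ℂ) * ((1 - t) * A + t * (e * B)) ^ ((-lam : ℝ) : ℂ) *
    ((1 - t) * P + t * (e * Q)) ^ ((-(lam + 1) : ℝ) : ℂ)

/-- The logarithmic derivative of `flowKernel` along `e d/de`. -/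
noncomputable def flowFactor (lam : ℝ) (A B P Q e : ℂ) (t : ℝ) : ℂ :=
  (lam + 1) - lam * (t * (e * B)) * ((1 - t) * A + t * (e * B))⁻¹ -
    (lam + 1) * (t * (e * Q)) * ((1 - t) * P + t * (e * Q))⁻¹

/-- The radii are chosen such that the bases in `flowKernel` stay in the ball of radius `1 / 2`
about `1`, hence in the right half-plane, where principal powers are multiplicative. -/
theorem mul_mem_ball_half {e x : ℂ} (he : e ∈ Metric.ball (1 : ℂ) (1 / 4))
    (hx : x ∈ Metric.ball (1 : ℂ) (1 / 16)) : e * x ∈ Metric.ball (1 : ℂ) (1 / 2) := by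
  rw [mem_ball_iff_norm] at *
  have h : e * x - 1 = (e - 1) * (x - 1) + (e - 1) + (x - 1) := by ring
  rw [h]
  refine ((norm_add_le _ _).trans (add_le_add_left (norm_add_le _ _) _)).trans_lt ?_
  rw [norm_mul]
  nlinarith [norm_nonneg (e - 1), norm_nonneg (x - 1)]

theorem hasDerivAt_flowKernel {t : ℝ} {e : ℂ} (he : e ∈ Metric.ball (1 : ℂ) (1 / 2))
    (hX : (1 - t) * A + t * (e * B) ∈ Metric.ball (1 : ℂ) (1 / 2))
    (hY : (1 - t) * P + t * (e * Q) ∈ Metric.ball (1 : ℂ) (1 / 2)) :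
    HasDerivAt (fun e => flowKernel lam A B P Q e t)
      (e⁻¹ * (flowKernel lam A B P Q e t * flowFactor lam A B P Q e t)) e := by
  have hsl : ∀ {x : ℂ}, x ∈ Metric.ball (1 : ℂ) (1 / 2) → x ∈ Complex.slitPlane := fun hx =>
    Or.inl (re_pos_of_mem_ball_one (by norm_num) hx)
  have he0 := Complex.slitPlane_ne_zero (hsl he)
  have hX0 := Complex.slitPlane_ne_zero (hsl hX)
  have hY0 := Complex.slitPlane_ne_zero (hsl hY)
  have hd : ∀ U V : ℂ, HasDerivAt (fun e : ℂ => (1 - t) * U + t * (e * V)) (t * (1 * V)) e :=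
    fun U V => (((hasDerivAt_id e).mul_const V).const_mul (t : ℂ)).const_add _
  have h1 := (hasDerivAt_id e).cpow_const (c := ((lam + 1 : ℝ) : ℂ)) (hsl he)
  have h2 := (hd A B).cpow_const (c := ((-lam : ℝ) : ℂ)) (hsl hX)
  have h3 := (hd P Q).cpow_const (c := ((-(lam + 1) : ℝ) : ℂ)) (hsl hY)
  convert! (h1.mul h2).mul h3 using 1
  simp only [flowKernel, flowFactor, id, Pi.mul_apply]
  rw [Complex.cpow_sub _ _ he0, Complex.cpow_sub _ _ hX0, Complex.cpow_sub _ _ hY0,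
    Complex.cpow_one, Complex.cpow_one, Complex.cpow_one]
  push_cast
  field_simp
  ring

/-- The function whose `t`-derivative is `e d/de` of the weighted kernel: the Möbius maps form the
flow of the vector field `s (1 - s) d/ds`, and the Lie derivative of a one-form on a line is exact.
The weight is `t (1 - t)` times the unnormalised density of the beta distribution. -/
theorem hasDerivAt_weight_mul_flowKernel {t : ℝ} (ht : t ∈ Ioo (0 : ℝ) 1) {e : ℂ}
    (hX : (1 - t) * A + t * (e * B) ∈ Metric.ball (1 : ℂ) (1 / 2))
    (hY : (1 - t) * P + t * (e * Q) ∈ Metric.ball (1 : ℂ) (1 / 2)) :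
    HasDerivAt (fun t : ℝ => ((t ^ (lam + 1) * (1 - t) ^ lam : ℝ) : ℂ) *
        flowKernel lam A B P Q e t)
      (((t ^ lam * (1 - t) ^ (lam - 1) : ℝ) : ℂ) *
        (flowKernel lam A B P Q e t * flowFactor lam A B P Q e t)) t := by
  have hsl : ∀ {x : ℂ}, x ∈ Metric.ball (1 : ℂ) (1 / 2) → x ∈ Complex.slitPlane := fun hx =>
    Or.inl (re_pos_of_mem_ball_one (by norm_num) hx)
  have hX0 := Complex.slitPlane_ne_zero (hsl hX)
  have hY0 := Complex.slitPlane_ne_zero (hsl hY)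
  have h0 := ht.1
  have h1' : 0 < 1 - t := by linarith [ht.2]
  have hw : HasDerivAt (fun t : ℝ => t ^ (lam + 1) * (1 - t) ^ lam)
      (t ^ lam * (1 - t) ^ (lam - 1) * ((lam + 1) * (1 - t) - lam * t)) t := by
    have h1 : HasDerivAt (fun t : ℝ => t ^ (lam + 1)) ((lam + 1) * t ^ (lam + 1 - 1)) t :=
      Real.hasDerivAt_rpow_const (Or.inl h0.ne')
    have h2 := ((hasDerivAt_id t).const_sub 1).rpow_const (p := lam) (Or.inl h1'.ne')
    convert! h1.mul h2 using 1
    have h3 : (1 - t) ^ lam = (1 - t) ^ (lam - 1) * (1 - t) := by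
      nth_rewrite 3 [← Real.rpow_one (1 - t)]
      rw [← Real.rpow_add h1', sub_add_cancel]
    simp only [id]
    rw [Real.rpow_add_one h0.ne', h3, add_sub_cancel_right]
    ring
  have hd : ∀ U V : ℂ, HasDerivAt (fun t : ℂ => (1 - t) * U + t * (e * V))
      (-1 * U + 1 * (e * V)) t := fun U V =>
    (((hasDerivAt_id (t : ℂ)).const_sub 1).mul_const U).add
      ((hasDerivAt_id (t : ℂ)).mul_const (e * V))
  have h2 := ((hd A B).cpow_const (c := ((-lam : ℝ) : ℂ)) (hsl hX)).comp_ofReal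
  have h3 := ((hd P Q).cpow_const (c := ((-(lam + 1) : ℝ) : ℂ)) (hsl hY)).comp_ofReal
  convert! hw.ofReal_comp.mul (((h2.const_mul (e ^ ((lam + 1 : ℝ) : ℂ))).mul h3)) using 1
  have h4 : t ^ (lam + 1) * (1 - t) ^ lam =
      t ^ lam * (1 - t) ^ (lam - 1) * (t * (1 - t)) := by
    rw [Real.rpow_add_one h0.ne', show lam = lam - 1 + 1 by ring, Real.rpow_add_one h1'.ne']
    ring_nf
  simp only [flowKernel, flowFactor, h4, Pi.mul_apply]
  rw [Complex.cpow_sub _ _ hX0, Complex.cpow_sub _ _ hY0, Complex.cpow_one, Complex.cpow_one]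
  generalize hXd : (1 - (t : ℂ)) * A + t * (e * B) = X at *
  generalize hYd : (1 - (t : ℂ)) * P + t * (e * Q) = Y at *
  have hA : (1 - (t : ℂ)) * A = X - t * (e * B) := by rw [← hXd]; ring
  have hP : (1 - (t : ℂ)) * P = Y - t * (e * Q) := by rw [← hYd]; ring
  generalize X ^ ((-lam : ℝ) : ℂ) = X' at *
  generalize Y ^ ((-(lam + 1) : ℝ) : ℂ) = Y' at *
  generalize e ^ ((lam + 1 : ℝ) : ℂ) = e' at *
  generalize t ^ lam * (1 - t) ^ (lam - 1) = w at *
  push_cast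
  field_simp
  linear_combination (-(lam : ℂ) * w * t * Y * e' * X' * Y') * hA -
    (((lam : ℂ) + 1) * w * t * X * e' * X' * Y') * hP

theorem continuousOn_flowKernel {e : ℂ}
    (hX : ∀ t ∈ Icc (0 : ℝ) 1, (1 - t) * A + t * (e * B) ∈ Metric.ball (1 : ℂ) (1 / 2))
    (hY : ∀ t ∈ Icc (0 : ℝ) 1, (1 - t) * P + t * (e * Q) ∈ Metric.ball (1 : ℂ) (1 / 2)) :
    ContinuousOn (flowKernel lam A B P Q e) (Icc 0 1) := by
  have hc : ∀ U V : ℂ, Continuous fun t : ℝ => (1 - (t : ℂ)) * U + t * V := fun U V => by fun_prop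
  refine (continuousOn_const.mul ?_).mul ?_
  · exact (hc A (e * B)).continuousOn.cpow continuousOn_const fun t ht =>
      Or.inl (re_pos_of_mem_ball_one (by norm_num) (hX t ht))
  · exact (hc P (e * Q)).continuousOn.cpow continuousOn_const fun t ht =>
      Or.inl (re_pos_of_mem_ball_one (by norm_num) (hY t ht))

theorem measurable_flowKernel (lam : ℝ) (A B P Q e : ℂ) :
    Measurable (flowKernel lam A B P Q e) := by
  unfold flowKernel
  fun_prop

theorem measurable_flowFactor (lam : ℝ) (A B P Q e : ℂ) :
    Measurable (flowFactor lam A B P Q e) := by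
  unfold flowFactor
  fun_prop

theorem norm_flowKernel_le {t : ℝ} {e : ℂ} (he : e ∈ Metric.ball (1 : ℂ) (1 / 2))
    (hX : (1 - t) * A + t * (e * B) ∈ Metric.ball (1 : ℂ) (1 / 2))
    (hY : (1 - t) * P + t * (e * Q) ∈ Metric.ball (1 : ℂ) (1 / 2)) :
    ‖flowKernel lam A B P Q e t‖ ≤ 2 ^ |lam + 1| * 2 ^ |-lam| * 2 ^ |-(lam + 1)| := by
  rw [flowKernel, norm_mul, norm_mul]
  have h1 := norm_cpow_le_two_rpow he (lam + 1)
  have h2 := norm_cpow_le_two_rpow hX (-lam)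
  have h3 := norm_cpow_le_two_rpow hY (-(lam + 1))
  gcongr

theorem norm_flowFactor_le (hlam : 0 ≤ lam) {t : ℝ} (ht : t ∈ Icc (0 : ℝ) 1) {e : ℂ}
    (hB : e * B ∈ Metric.ball (1 : ℂ) (1 / 2)) (hQ : e * Q ∈ Metric.ball (1 : ℂ) (1 / 2))
    (hX : (1 - t) * A + t * (e * B) ∈ Metric.ball (1 : ℂ) (1 / 2))
    (hY : (1 - t) * P + t * (e * Q) ∈ Metric.ball (1 : ℂ) (1 / 2)) :
    ‖flowFactor lam A B P Q e t‖ ≤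
      (lam + 1) + lam * (1 * 2) * 2 + (lam + 1) * (1 * 2) * 2 := by
  have h1 : ‖(lam : ℂ) + 1‖ = lam + 1 := by
    rw [← Complex.ofReal_one, ← Complex.ofReal_add, Complex.norm_real,
      Real.norm_of_nonneg (by positivity)]
  have h2 : ‖(t : ℂ)‖ ≤ 1 := by
    rw [Complex.norm_real, Real.norm_of_nonneg ht.1]
    exact ht.2
  have h3 : ‖(lam : ℂ)‖ = lam := by rw [Complex.norm_real, Real.norm_of_nonneg hlam]
  refine (norm_sub_le _ _).trans (add_le_add ((norm_sub_le _ _).trans (add_le_add h1.le ?_)) ?_)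
  · rw [norm_mul, norm_mul, norm_mul (t : ℂ), h3]
    have := norm_inv_le_two hX
    have := norm_le_two hB
    gcongr
  · rw [norm_mul, norm_mul, norm_mul (t : ℂ), h1]
    have := norm_inv_le_two hY
    have := norm_le_two hQ
    gcongr

/-- The integral of the `e`-derivative vanishes, because that derivative is the `t`-derivative of a
function with vanishing boundary values. -/
theorem integral_flowKernel_mul_flowFactor (hlam : 0 < lam) {e : ℂ}
    (hint : Integrable (fun t => flowKernel lam A B P Q e t * flowFactor lam A B P Q e t)
      (betaMeasure (lam + 1) lam))
    (hX : ∀ t ∈ Icc (0 : ℝ) 1, (1 - t) * A + t * (e * B) ∈ Metric.ball (1 : ℂ) (1 / 2))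
    (hY : ∀ t ∈ Icc (0 : ℝ) 1, (1 - t) * P + t * (e * Q) ∈ Metric.ball (1 : ℂ) (1 / 2)) :
    ∫ t, flowKernel lam A B P Q e t * flowFactor lam A B P Q e t ∂(betaMeasure (lam + 1) lam) =
      0 := by
  have hl1 : 0 < lam + 1 := by positivity
  have hβ := (beta_pos hl1 hlam).ne'
  rw [integral_betaMeasure hl1 hlam]
  have hI := (integrableOn_betaDensity_smul hl1 hlam hint).const_mul ((beta (lam + 1) lam : ℝ) : ℂ)
  have heq : ∀ t ∈ Ioo (0 : ℝ) 1, ((beta (lam + 1) lam : ℝ) : ℂ) *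
      ((1 / beta (lam + 1) lam * t ^ (lam + 1 - 1) * (1 - t) ^ (lam - 1)) •
        (flowKernel lam A B P Q e t * flowFactor lam A B P Q e t)) =
      ((t ^ lam * (1 - t) ^ (lam - 1) : ℝ) : ℂ) *
        (flowKernel lam A B P Q e t * flowFactor lam A B P Q e t) := by
    intro t _
    rw [add_sub_cancel_right, Complex.real_smul, ← mul_assoc, ← Complex.ofReal_mul]
    congr 2
    field_simp
  have hI' := IntegrableOn.congr_fun hI heq measurableSet_Ioo
  have hcont : ContinuousOn (fun t : ℝ => ((t ^ (lam + 1) * (1 - t) ^ lam : ℝ) : ℂ) *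
      flowKernel lam A B P Q e t) (Icc 0 1) := by
    refine ContinuousOn.mul ?_ (continuousOn_flowKernel hX hY)
    refine Complex.continuous_ofReal.comp_continuousOn (ContinuousOn.mul ?_ ?_)
    · exact continuousOn_id.rpow_const fun _ _ => Or.inr hl1.le
    · exact (continuousOn_const.sub continuousOn_id).rpow_const fun _ _ => Or.inr hlam.le
  have hFTC := intervalIntegral.integral_eq_sub_of_hasDerivAt_of_le zero_le_one hcont
    (fun t ht => hasDerivAt_weight_mul_flowKernel ht (hX t (Ioo_subset_Icc_self ht))
      (hY t (Ioo_subset_Icc_self ht)))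
    ((intervalIntegrable_iff_integrableOn_Ioo_of_le zero_le_one).2 hI')
  rw [intervalIntegral.integral_of_le zero_le_one, integral_Ioc_eq_integral_Ioo,
    ← setIntegral_congr_fun measurableSet_Ioo heq, integral_const_mul] at hFTC
  simpa [Real.zero_rpow hlam.ne', Real.zero_rpow hl1.ne', hβ] using hFTC

/-- The integral of `flowKernel` does not depend on `e`. -/
theorem integral_flowKernel_eq (hlam : 0 < lam) (hA : A ∈ Metric.ball (1 : ℂ) (1 / 16))
    (hB : B ∈ Metric.ball (1 : ℂ) (1 / 16)) (hP : P ∈ Metric.ball (1 : ℂ) (1 / 16))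
    (hQ : Q ∈ Metric.ball (1 : ℂ) (1 / 16)) {e : ℂ} (he : e ∈ Metric.ball (1 : ℂ) (1 / 4)) :
    ∫ t, flowKernel lam A B P Q e t ∂(betaMeasure (lam + 1) lam) =
      ∫ t, flowKernel lam A B P Q 1 t ∂(betaMeasure (lam + 1) lam) := by
  have hl1 : 0 < lam + 1 := by positivity
  have := isProbabilityMeasureBeta hl1 hlam
  have hb : ∀ {x : ℂ} {ε : ℝ}, ε ≤ 1 / 2 → x ∈ Metric.ball (1 : ℂ) ε →
      x ∈ Metric.ball (1 : ℂ) (1 / 2) := fun h hx => Metric.ball_subset_ball h hx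
  have hX : ∀ e ∈ Metric.ball (1 : ℂ) (1 / 4), ∀ t ∈ Icc (0 : ℝ) 1,
      (1 - t) * A + t * (e * B) ∈ Metric.ball (1 : ℂ) (1 / 2) := fun e he t ht =>
    segment_mem_ball (hb (by norm_num) hA) (mul_mem_ball_half he hB) ht
  have hY : ∀ e ∈ Metric.ball (1 : ℂ) (1 / 4), ∀ t ∈ Icc (0 : ℝ) 1,
      (1 - t) * P + t * (e * Q) ∈ Metric.ball (1 : ℂ) (1 / 2) := fun e he t ht =>
    segment_mem_ball (hb (by norm_num) hP) (mul_mem_ball_half he hQ) ht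
  have hae : ∀ᵐ t ∂(betaMeasure (lam + 1) lam), t ∈ Icc (0 : ℝ) 1 :=
    (ae_mem_Ioo_betaMeasure _ _).mono fun t ht => Ioo_subset_Icc_self ht
  set K : ℝ := 2 ^ |lam + 1| * 2 ^ |-lam| * 2 ^ |-(lam + 1)| with hK
  set L : ℝ := (lam + 1) + lam * (1 * 2) * 2 + (lam + 1) * (1 * 2) * 2 with hL
  have hKb : ∀ e ∈ Metric.ball (1 : ℂ) (1 / 4), ∀ t ∈ Icc (0 : ℝ) 1,
      ‖flowKernel lam A B P Q e t‖ ≤ K := fun e he t ht =>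
    norm_flowKernel_le (hb (by norm_num) he) (hX e he t ht) (hY e he t ht)
  have hLb : ∀ e ∈ Metric.ball (1 : ℂ) (1 / 4), ∀ t ∈ Icc (0 : ℝ) 1,
      ‖flowFactor lam A B P Q e t‖ ≤ L := fun e he t ht =>
    norm_flowFactor_le hlam.le ht (mul_mem_ball_half he hB) (mul_mem_ball_half he hQ)
      (hX e he t ht) (hY e he t ht)
  have hprod : ∀ e ∈ Metric.ball (1 : ℂ) (1 / 4), ∀ t ∈ Icc (0 : ℝ) 1,
      ‖flowKernel lam A B P Q e t * flowFactor lam A B P Q e t‖ ≤ K * L := by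
    intro e he t ht
    rw [norm_mul]
    exact mul_le_mul (hKb e he t ht) (hLb e he t ht) (norm_nonneg _)
      ((norm_nonneg _).trans (hKb e he t ht))
  have hd : ∀ e ∈ Metric.ball (1 : ℂ) (1 / 4), HasDerivAt
      (fun e => ∫ t, flowKernel lam A B P Q e t ∂(betaMeasure (lam + 1) lam)) 0 e := by
    intro e he
    have hmeas : Measurable fun t => flowKernel lam A B P Q e t * flowFactor lam A B P Q e t :=
      (measurable_flowKernel lam A B P Q e).mul (measurable_flowFactor lam A B P Q e)
    have hint : Integrable (fun t => flowKernel lam A B P Q e t * flowFactor lam A B P Q e t)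
        (betaMeasure (lam + 1) lam) :=
      Integrable.of_bound hmeas.aestronglyMeasurable (K * L) (hae.mono (hprod e he))
    have h := (hasDerivAt_integral_of_dominated_loc_of_deriv_le
      (μ := betaMeasure (lam + 1) lam) (F := flowKernel lam A B P Q)
      (F' := fun e t => e⁻¹ * (flowKernel lam A B P Q e t * flowFactor lam A B P Q e t))
      (bound := fun _ => 2 * (K * L)) (Metric.isOpen_ball.mem_nhds he)
      (Filter.Eventually.of_forall fun e =>
        (measurable_flowKernel lam A B P Q e).aestronglyMeasurable)
      (Integrable.of_bound (measurable_flowKernel lam A B P Q e).aestronglyMeasurable K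
        (hae.mono (hKb e he)))
      (hmeas.const_mul _).aestronglyMeasurable ?_ (integrable_const _) ?_).2
    · rwa [integral_const_mul,
        integral_flowKernel_mul_flowFactor hlam hint (hX e he) (hY e he), mul_zero] at h
    · filter_upwards [hae] with t ht z hz
      rw [norm_mul]
      exact mul_le_mul (norm_inv_le_two (hb (by norm_num) hz)) (hprod z hz t ht) (norm_nonneg _)
        zero_le_two
    · filter_upwards [hae] with t ht z hz
      exact hasDerivAt_flowKernel (hb (by norm_num) hz) (hX z hz t ht) (hY z hz t ht)
  exact Metric.isOpen_ball.is_const_of_deriv_eq_zero (convex_ball _ _).isPreconnected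
    (fun e he => (hd e he).differentiableAt.differentiableWithinAt)
    (fun e he => (hd e he).deriv) he (Metric.mem_ball_self (by norm_num))

theorem div_mem_ball_quarter (hP : P ∈ Metric.ball (1 : ℂ) (1 / 16))
    (hQ : Q ∈ Metric.ball (1 : ℂ) (1 / 16)) : P / Q ∈ Metric.ball (1 : ℂ) (1 / 4) := by
  have hQ2 := norm_inv_le_two (Metric.ball_subset_ball (by norm_num) hQ)
  have hQ0 : Q ≠ 0 := fun h => by
    rw [h] at hQ
    norm_num at hQ
  rw [mem_ball_iff_norm] at *
  have h : P / Q - 1 = ((P - 1) - (Q - 1)) * Q⁻¹ := by field_simp; ring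
  rw [h, norm_mul]
  have h1 := norm_sub_le (P - 1) (Q - 1)
  nlinarith [norm_nonneg ((P - 1) - (Q - 1)), norm_nonneg Q⁻¹]

/-- The Euler-type integral with four branch points and its hypergeometric normal form agree when
all the bases are close to `1`. The two differ by the Möbius change of variable with parameter
`e = P / Q`; for complex `e` it would move the path of integration off the real axis, so it is
realised as the end point of a flow. -/
theorem integral_betaMeasure_moebius (hlam : 0 < lam) (hA : A ∈ Metric.ball (1 : ℂ) (1 / 16))
    (hB : B ∈ Metric.ball (1 : ℂ) (1 / 16)) (hP : P ∈ Metric.ball (1 : ℂ) (1 / 16))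
    (hQ : Q ∈ Metric.ball (1 : ℂ) (1 / 16)) :
    ∫ t : ℝ, ((1 - t) * A + t * B) ^ ((-lam : ℝ) : ℂ) *
        ((1 - t) * P + t * Q) ^ ((-(lam + 1) : ℝ) : ℂ) ∂(betaMeasure (lam + 1) lam) =
      ∫ t : ℝ, Q⁻¹ * ((1 - t) * (A * Q) + t * (B * P)) ^ ((-lam : ℝ) : ℂ)
        ∂(betaMeasure (lam + 1) lam) := by
  have he := div_mem_ball_quarter hP hQ
  have h := integral_flowKernel_eq hlam hA hB hP hQ he
  simp only [flowKernel, one_mul, Complex.one_cpow] at h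
  rw [← h]
  have hQre := re_pos_of_mem_ball_one (by norm_num) hQ
  have here := re_pos_of_mem_ball_one (by norm_num) he
  have hQ0 : Q ≠ 0 := fun h => by simp [h] at hQre
  have hP0 : P ≠ 0 := fun h => by
    have := re_pos_of_mem_ball_one (by norm_num) hP
    simp [h] at this
  refine integral_congr_ae ?_
  filter_upwards [ae_mem_Ioo_betaMeasure (lam + 1) lam] with t ht
  have hX := re_pos_of_mem_ball_one (by norm_num) (segment_mem_ball
    (Metric.ball_subset_ball (show (1 / 16 : ℝ) ≤ 1 / 2 by norm_num) hA)
    (mul_mem_ball_half he hB) (Ioo_subset_Icc_self ht))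
  have h1 : (1 - (t : ℂ)) * P + t * (P / Q * Q) = Q * (P / Q) := by field_simp; ring
  have h2 : (1 - (t : ℂ)) * (A * Q) + t * (B * P) =
      Q * ((1 - t) * A + t * (P / Q * B)) := by field_simp
  rw [h1, h2, mul_cpow_of_re_pos hQre here, mul_cpow_of_re_pos hQre hX,
    show ((-(lam + 1) : ℝ) : ℂ) = -((lam + 1 : ℝ) : ℂ) by push_cast; ring, Complex.cpow_neg (P / Q),
    show -((lam + 1 : ℝ) : ℂ) = -1 + ((-lam : ℝ) : ℂ) by push_cast; ring,
    Complex.cpow_add _ _ hQ0, Complex.cpow_neg_one]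
  have h3 : (P / Q) ^ ((lam + 1 : ℝ) : ℂ) ≠ 0 := by
    rw [Complex.cpow_def_of_ne_zero (div_ne_zero hP0 hQ0)]
    exact Complex.exp_ne_zero _
  field_simp

end Flow

/-! ### Measures representing the kernel -/

section KernelMeasure

open MeasureTheory ProbabilityTheory Set

/-- The properties of a probability measure on `[0, 1]` from which the integral representation of
the `λ`-Cauchy kernel and its estimates follow: its moments along a segment are the normalised
`lamPoly`, it satisfies the Möbius identity for bases close to `1`, and negative powers of
convex combinations have integrals of the expected size. It is a beta distribution for `λ > 0`,
degenerating to the unit mass at `1` for `λ = 0`. -/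
structure IsKernelMeasure (lam : ℝ) (μ : Measure ℝ) : Prop where
  isProbabilityMeasure : IsProbabilityMeasure μ
  ae_mem_Icc : ∀ᵐ t ∂μ, t ∈ Icc (0 : ℝ) 1
  integral_segment_pow : ∀ (n : ℕ) (x y : ℂ), ∫ t : ℝ, ((t : ℂ) * x + (1 - t) * y) ^ n ∂μ =
    (((Nat.factorial n : ℝ) / (ascPochhammer ℝ n).eval (2 * lam + 1) : ℝ) : ℂ) * lamPoly lam n x y
  integral_moebius : ∀ A ∈ Metric.ball (1 : ℂ) (1 / 16), ∀ B ∈ Metric.ball (1 : ℂ) (1 / 16),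
    ∀ P ∈ Metric.ball (1 : ℂ) (1 / 16), ∀ Q ∈ Metric.ball (1 : ℂ) (1 / 16),
      ∫ t : ℝ, ((1 - t) * A + t * B) ^ ((-lam : ℝ) : ℂ) *
        ((1 - t) * P + t * Q) ^ ((-(lam + 1) : ℝ) : ℂ) ∂μ =
      ∫ t : ℝ, Q⁻¹ * ((1 - t) * (A * Q) + t * (B * P)) ^ ((-lam : ℝ) : ℂ) ∂μ
  integral_rpow_le : ∃ C : ℝ, 0 ≤ C ∧ ∀ A B : ℝ, 0 < A → 0 < B →
    ∫ t, ((1 - t) * A ^ 2 + t * B ^ 2) ^ (-lam) ∂μ ≤ C * B ^ (-2 * lam)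
  integral_rpow_sub_half_le : ∃ C : ℝ, 0 ≤ C ∧ ∀ A B : ℝ, 0 < A → 0 < B → B ≤ A →
    ∫ t, ((1 - t) * A ^ 2 + t * B ^ 2) ^ (-lam - 1 / 2) ∂μ ≤ C * (A ^ (-2 * lam) / B)

theorem isKernelMeasure_betaMeasure {lam : ℝ} (hlam : 0 < lam) :
    IsKernelMeasure lam (betaMeasure (lam + 1) lam) where
  isProbabilityMeasure := isProbabilityMeasureBeta (by positivity) hlam
  ae_mem_Icc := (ae_mem_Ioo_betaMeasure _ _).mono fun _ ht => Ioo_subset_Icc_self ht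
  integral_segment_pow := integral_segment_pow_betaMeasure hlam
  integral_moebius _ hA _ hB _ hP _ hQ := integral_betaMeasure_moebius hlam hA hB hP hQ
  integral_rpow_le := integral_rpow_convexCombo_le hlam
  integral_rpow_sub_half_le := integral_rpow_convexCombo_sub_half_le hlam

theorem isKernelMeasure_dirac : IsKernelMeasure 0 (Measure.dirac 1) where
  isProbabilityMeasure := inferInstance
  ae_mem_Icc := by simp [ae_dirac_eq]
  integral_segment_pow n x y := by
    have h : lamPoly 0 n x y = x ^ n := by
      rw [lamPoly, Finset.sum_eq_single 0]
      · simp [ascPochhammer_eval_one, Nat.factorial_ne_zero]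
      · intro j _ hj
        simp [hj]
      · simp
    simp [h, ascPochhammer_eval_one, Nat.factorial_ne_zero]
  integral_moebius A _ B _ P _ Q _ := by
    simp [Complex.cpow_neg_one]
  integral_rpow_le := ⟨1, zero_le_one, fun A B _ _ => by simp⟩
  integral_rpow_sub_half_le := by
    refine ⟨1, zero_le_one, fun A B hA hB _ => ?_⟩
    rw [integral_dirac, sub_self, zero_mul, zero_add, one_mul, one_mul, ← Real.rpow_natCast B 2,
      ← Real.rpow_mul hB.le, show ((2 : ℕ) : ℝ) * (-0 - 1 / 2) = -1 by norm_num, mul_zero,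
      Real.rpow_zero, Real.rpow_neg_one, one_div]

theorem exists_isKernelMeasure {lam : ℝ} (hlam : 0 ≤ lam) : ∃ μ, IsKernelMeasure lam μ := by
  rcases hlam.eq_or_lt with rfl | h
  · exact ⟨_, isKernelMeasure_dirac⟩
  · exact ⟨_, isKernelMeasure_betaMeasure h⟩

/-! ### Integral representations of the kernel -/

variable {lam : ℝ} {μ : Measure ℝ}

theorem lamPhi_mul_conj_lamPhi (hlam : 0 ≤ lam) (n : ℕ) (z w : ℂ) :
    lamPhi lam n z * conj (lamPhi lam n w) =
      (((Nat.factorial n : ℝ) / (ascPochhammer ℝ n).eval (2 * lam + 1) : ℝ) : ℂ) *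
        lamPoly lam n z (conj z) * lamPoly lam n (conj w) w := by
  have h : 0 ≤ (Nat.factorial n : ℝ) / (ascPochhammer ℝ n).eval (2 * lam + 1) :=
    div_nonneg (Nat.cast_nonneg _) (ascPochhammer_pos n _ (by positivity)).le
  rw [lamPhi_eq, lamPhi_eq, map_mul, Complex.conj_ofReal, conj_lamPoly, Complex.conj_conj,
    ← Real.mul_self_sqrt h, ← lamEps]
  push_cast
  ring

theorem norm_segment_le {x y : ℂ} {c t : ℝ} (hx : ‖x‖ ≤ c) (hy : ‖y‖ ≤ c)
    (ht : t ∈ Icc (0 : ℝ) 1) : ‖(t : ℂ) * x + (1 - t) * y‖ ≤ c := by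
  have h := (convex_closedBall (0 : ℂ) c) (mem_closedBall_zero_iff.2 hx)
    (mem_closedBall_zero_iff.2 hy) ht.1 (sub_nonneg.2 ht.2) (add_sub_cancel t 1)
  simpa using! h

theorem IsKernelMeasure.norm_integral_segment_pow_le (hμ : IsKernelMeasure lam μ) {x y : ℂ}
    (hx : ‖x‖ ≤ 1) (hy : ‖y‖ ≤ 1) (n : ℕ) :
    ‖∫ t : ℝ, ((t : ℂ) * x + (1 - t) * y) ^ n ∂μ‖ ≤ 1 := by
  have := hμ.isProbabilityMeasure
  refine (norm_integral_le_of_norm_le_const (C := 1) ?_).trans (by simp)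
  filter_upwards [hμ.ae_mem_Icc] with t ht
  rw [norm_pow]
  exact pow_le_one₀ (norm_nonneg _) (norm_segment_le hx hy ht)

/-- One factor of each term is a moment, hence at most `1`; the other one is a coefficient of a
power series converging beyond `1`. -/
theorem summable_norm_lamPhi_mul_conj (hlam : 0 ≤ lam) {z w : ℂ} (hz : ‖z‖ < 1) (hw : ‖w‖ < 1) :
    Summable fun n : ℕ => ‖lamPhi lam n z * conj (lamPhi lam n w)‖ := by
  obtain ⟨μ, hμ⟩ := exists_isKernelMeasure hlam
  refine Summable.of_nonneg_of_le (fun _ => norm_nonneg _) (fun n => ?_)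
    (summable_norm_lamPoly lam (x := conj w) (y := w) (by simpa using hw) hw)
  rw [lamPhi_mul_conj_lamPhi hlam, ← hμ.integral_segment_pow, norm_mul]
  exact mul_le_of_le_one_left (norm_nonneg _)
    (hμ.norm_integral_segment_pow_le hz.le (by simpa using hz.le) n)

/-- The kernel as the integral of the generating function of `lamPoly` over the segment joining
`z̄` to `z`. -/
theorem IsKernelMeasure.lamCauchy_eq_integral_segment (hμ : IsKernelMeasure lam μ)
    (hlam : 0 ≤ lam) {z w : ℂ} (hz : ‖z‖ < 1) (hw : ‖w‖ < 1) :
    lamCauchy lam z w = ∫ t : ℝ,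
      (1 - ((t : ℂ) * z + (1 - t) * conj z) * conj w) ^ ((-(lam + 1) : ℝ) : ℂ) *
      (1 - ((t : ℂ) * z + (1 - t) * conj z) * w) ^ ((-lam : ℝ) : ℂ) ∂μ := by
  have := hμ.isProbabilityMeasure
  have hz' : ‖conj z‖ ≤ 1 := by simpa using hz.le
  have hw' : ‖conj w‖ < 1 := by simpa using hw
  set Z : ℝ → ℂ := fun t => (t : ℂ) * z + (1 - t) * conj z with hZ
  set F : ℕ → ℝ → ℂ := fun n t => Z t ^ n * lamPoly lam n (conj w) w with hF
  have hFb : ∀ n, ∀ᵐ t ∂μ, ‖F n t‖ ≤ ‖lamPoly lam n (conj w) w‖ := by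
    intro n
    filter_upwards [hμ.ae_mem_Icc] with t ht
    rw [hF, norm_mul, norm_pow]
    exact mul_le_of_le_one_left (norm_nonneg _)
      (pow_le_one₀ (norm_nonneg _) (norm_segment_le hz.le hz' ht))
  have hFm : ∀ n, AEStronglyMeasurable (F n) μ := fun n => by
    have : Continuous (F n) := by fun_prop
    exact this.aestronglyMeasurable
  have hFi : ∀ n, Integrable (F n) μ := fun n => Integrable.of_bound (hFm n) _ (hFb n)
  have hs : Summable fun n => ∫ t, ‖F n t‖ ∂μ := by
    refine Summable.of_nonneg_of_le (fun n => integral_nonneg fun t => norm_nonneg _) (fun n => ?_)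
      (summable_norm_lamPoly lam hw' hw)
    calc ∫ t, ‖F n t‖ ∂μ ≤ ∫ _, ‖lamPoly lam n (conj w) w‖ ∂μ :=
          integral_mono_ae (hFi n).norm (integrable_const _) (hFb n)
      _ = _ := by simp
  rw [lamCauchy, ← (integral_congr_ae ?_ : ∫ t, ∑' n, F n t ∂μ = _),
    ← (hasSum_integral_of_summable_integral_norm hFi hs).tsum_eq]
  · refine tsum_congr fun n => ?_
    rw [lamPhi_mul_conj_lamPhi hlam, ← hμ.integral_segment_pow, hF, integral_mul_const]
  · filter_upwards [hμ.ae_mem_Icc] with t ht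
    have hZ1 : ‖Z t‖ ≤ 1 := norm_segment_le hz.le hz' ht
    have hlt : ∀ {u : ℂ}, ‖u‖ < 1 → ‖Z t * u‖ < 1 := fun hu => by
      rw [norm_mul]
      exact (mul_le_of_le_one_left (norm_nonneg _) hZ1).trans_lt hu
    have h := hasSum_lamPoly lam (hlt hw') (hlt hw)
    simp only [lamPoly_smul] at h
    exact h.tsum_eq

/-- The convex combination `(1 - t) Re (q w̄) + t Re (q w)`. -/
noncomputable def midRe (q w : ℂ) (t : ℝ) : ℝ := (1 - t) * (q * conj w).re + t * (q * w).re

/-- For `|q| = 1`, the root `ζ` in the factorisation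
`(1 - t) |1 - r q w̄|² + t |1 - r q w|² = (1 - r ζ) (1 - r ζ̄)`: it has modulus `|w|` and real part
`midRe q w t`. -/
noncomputable def midRoot (q w : ℂ) (t : ℝ) : ℂ :=
  (midRe q w t : ℂ) + (√(‖w‖ ^ 2 - midRe q w t ^ 2) : ℝ) * Complex.I

theorem measurable_midRoot (q w : ℂ) : Measurable (midRoot q w) := by
  have : Continuous (midRe q w) := by unfold midRe; fun_prop
  have : Continuous (midRoot q w) := by unfold midRoot; fun_prop
  exact this.measurable

theorem midRoot_mul_conj {q w : ℂ} (hq : ‖q‖ = 1) {t : ℝ} (ht : t ∈ Icc (0 : ℝ) 1) :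
    midRoot q w t * conj (midRoot q w t) = (‖w‖ ^ 2 : ℝ) := by
  have h1 : |(q * conj w).re| ≤ ‖w‖ := by
    simpa [hq] using Complex.abs_re_le_norm (q * conj w)
  have h2 : |(q * w).re| ≤ ‖w‖ := by simpa [hq] using Complex.abs_re_le_norm (q * w)
  have h3 : |midRe q w t| ≤ ‖w‖ := by
    rw [abs_le] at *
    have h4 := ht.1
    have h5 : 0 ≤ 1 - t := sub_nonneg.2 ht.2
    constructor <;> unfold midRe <;> nlinarith
  have h4 : 0 ≤ ‖w‖ ^ 2 - midRe q w t ^ 2 :=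
    sub_nonneg.2 (sq_le_sq' (abs_le.1 h3).1 (abs_le.1 h3).2)
  rw [Complex.mul_conj, midRoot, Complex.normSq_add_mul_I, Real.sq_sqrt h4]
  congr 1
  ring

theorem norm_midRoot {q w : ℂ} (hq : ‖q‖ = 1) {t : ℝ} (ht : t ∈ Icc (0 : ℝ) 1) :
    ‖midRoot q w t‖ = ‖w‖ := by
  have h := midRoot_mul_conj (w := w) hq ht
  rw [Complex.mul_conj, Complex.normSq_eq_norm_sq, Complex.ofReal_inj] at h
  exact (sq_eq_sq₀ (norm_nonneg _) (norm_nonneg _)).1 h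

theorem one_sub_midRoot_mul {q w : ℂ} (hq : ‖q‖ = 1) {t : ℝ} (ht : t ∈ Icc (0 : ℝ) 1) (r : ℂ) :
    (1 - r * midRoot q w t) * (1 - r * conj (midRoot q w t)) =
      (1 - t) * ((1 - r * (conj q * w)) * (1 - r * (q * conj w))) +
        t * ((1 - r * (q * w)) * (1 - r * (conj q * conj w))) := by
  have h1 := midRoot_mul_conj (w := w) hq ht
  have h2 : midRoot q w t + conj (midRoot q w t) = 2 * (midRe q w t : ℂ) := by
    rw [Complex.add_conj, midRoot]
    simp
  have h3 : q * conj q = 1 := by rw [Complex.mul_conj, Complex.normSq_eq_norm_sq, hq]; simp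
  have h4 : w * conj w = (‖w‖ ^ 2 : ℝ) := by rw [Complex.mul_conj, Complex.normSq_eq_norm_sq]
  have h5 : q * conj w + conj q * w = 2 * ((q * conj w).re : ℂ) := by
    have := Complex.add_conj (q * conj w)
    simpa using this
  have h6 : q * w + conj q * conj w = 2 * ((q * w).re : ℂ) := by
    have := Complex.add_conj (q * w)
    simpa using this
  have h7 : (midRe q w t : ℂ) = (1 - t) * ((q * conj w).re : ℂ) + t * ((q * w).re : ℂ) := by
    unfold midRe
    push_cast
    ring
  linear_combination r ^ 2 * h1 - r * h2 - 2 * r * h7 + r * (1 - t) * h5 + r * t * h6 -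
    r ^ 2 * h4 - r ^ 2 * (w * conj w) * h3

/-- The bases of the integrand along the segment from `z̄` to `z`, where `z = r q`. -/
noncomputable def segmentBase (q w : ℂ) : Fin 2 → ℝ → ℂ :=
  ![fun t => ((t : ℂ) * q + (1 - t) * conj q) * conj w,
    fun t => ((t : ℂ) * q + (1 - t) * conj q) * w]

/-- The bases of the integrand in the representation
`C(r q, w) = ∫ (1 - r q w̄)⁻¹ (1 - r ζ) ^ (-λ) (1 - r ζ̄) ^ (-λ)`. -/
noncomputable def rootBase (q w : ℂ) : Fin 3 → ℝ → ℂ :=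
  ![fun _ => q * conj w, midRoot q w, fun t => conj (midRoot q w t)]

theorem measurable_segmentBase (q w : ℂ) (l : Fin 2) : Measurable (segmentBase q w l) := by
  fin_cases l <;> simp only [segmentBase] <;> simp <;> fun_prop

theorem measurable_rootBase (q w : ℂ) (l : Fin 3) : Measurable (rootBase q w l) := by
  have h := measurable_midRoot q w
  fin_cases l
  · exact measurable_const
  · exact h
  · exact Complex.continuous_conj.measurable.comp h

theorem norm_segmentBase_le {q w : ℂ} (hq : ‖q‖ = 1) {t : ℝ} (ht : t ∈ Icc (0 : ℝ) 1)
    (l : Fin 2) : ‖segmentBase q w l t‖ ≤ ‖w‖ := by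
  have h : ‖(t : ℂ) * q + (1 - t) * conj q‖ ≤ 1 :=
    norm_segment_le hq.le (by simpa using hq.le) ht
  fin_cases l
  · change ‖((t : ℂ) * q + (1 - t) * conj q) * conj w‖ ≤ ‖w‖
    rw [norm_mul, Complex.norm_conj]
    exact mul_le_of_le_one_left (norm_nonneg _) h
  · change ‖((t : ℂ) * q + (1 - t) * conj q) * w‖ ≤ ‖w‖
    rw [norm_mul]
    exact mul_le_of_le_one_left (norm_nonneg _) h

theorem norm_rootBase_le {q w : ℂ} (hq : ‖q‖ = 1) {t : ℝ} (ht : t ∈ Icc (0 : ℝ) 1)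
    (l : Fin 3) : ‖rootBase q w l t‖ ≤ ‖w‖ := by
  fin_cases l
  · change ‖q * conj w‖ ≤ ‖w‖
    simp [hq]
  · exact (norm_midRoot hq ht).le
  · change ‖conj (midRoot q w t)‖ ≤ ‖w‖
    rw [Complex.norm_conj]
    exact (norm_midRoot hq ht).le

/-- The exponents that go with `rootBase`. -/
def rootExp (lam : ℝ) : Fin 3 → ℝ := ![1, lam, lam]

theorem rootExp_nonneg (hlam : 0 ≤ lam) (l : Fin 3) : 0 ≤ rootExp lam l := by
  fin_cases l
  · exact zero_le_one
  · exact hlam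
  · exact hlam

/-- Near `r = 0` the Möbius identity turns one representation into the other. -/
theorem IsKernelMeasure.powInt_segmentBase_eq_of_small (hμ : IsKernelMeasure lam μ) {q w r : ℂ}
    (hq : ‖q‖ = 1) (hw : ‖w‖ < 1) (hr : ‖r‖ < 1 / 16) :
    powInt μ (segmentBase q w) ![lam + 1, lam] r = powInt μ (rootBase q w) (rootExp lam) r := by
  have hq' : ‖conj q‖ = 1 := by simpa using hq
  have hw' : ‖conj w‖ < 1 := by simpa using hw
  have hlt : ∀ {u : ℂ}, ‖u‖ ≤ 1 → ‖r * u‖ < 1 / 16 := fun hu => by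
    rw [norm_mul]
    exact (mul_le_of_le_one_right (norm_nonneg _) hu).trans_lt hr
  have hball : ∀ {u v : ℂ}, ‖u‖ = 1 → ‖v‖ < 1 → 1 - r * (u * v) ∈ Metric.ball (1 : ℂ) (1 / 16) :=
    fun hu hv => by
      rw [mem_ball_iff_norm, sub_sub_cancel_left, norm_neg]
      exact hlt (by rw [norm_mul, hu, one_mul]; exact hv.le)
  have hre : ∀ {u : ℂ}, ‖u‖ ≤ 1 → 0 < (1 - r * u).re := fun {u} hu => by
    rw [Complex.sub_re, Complex.one_re]
    linarith [hlt hu, Complex.re_le_norm (r * u)]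
  have h := hμ.integral_moebius _ (hball hq' hw) _ (hball hq hw) _ (hball hq' hw') _
    (hball hq hw')
  unfold powInt
  refine Eq.trans (integral_congr_ae (Filter.Eventually.of_forall fun t => ?_))
    (h.trans (integral_congr_ae ?_))
  · simp only [powProd, segmentBase, Fin.prod_univ_two, Matrix.cons_val_zero, Matrix.cons_val_one]
    rw [mul_comm]
    congr 2 <;> ring
  · filter_upwards [hμ.ae_mem_Icc] with t ht
    have hn := (norm_midRoot (w := w) hq ht).trans_le hw.le
    simp only [powProd, rootBase, rootExp, Fin.prod_univ_three, Matrix.cons_val_zero,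
      Matrix.cons_val_one, Matrix.cons_val]
    rw [← one_sub_midRoot_mul hq ht, mul_cpow_of_re_pos (hre hn) (hre (by simpa using hn)),
      mul_assoc, show ((-1 : ℝ) : ℂ) = -1 by norm_num, Complex.cpow_neg_one]

theorem IsKernelMeasure.powInt_segmentBase_eq (hμ : IsKernelMeasure lam μ) (hlam : 0 ≤ lam)
    {q w : ℂ} (hq : ‖q‖ = 1) (hw : ‖w‖ < 1) :
    EqOn (powInt μ (segmentBase q w) ![lam + 1, lam]) (powInt μ (rootBase q w) (rootExp lam))
      (Metric.ball 0 1) := by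
  have := hμ.isProbabilityMeasure
  have hs : ∀ l, 0 ≤ (![lam + 1, lam] : Fin 2 → ℝ) l := by
    intro l
    fin_cases l
    · exact add_nonneg hlam zero_le_one
    · exact hlam
  have h1 := (differentiableOn_powInt (measurable_segmentBase q w) hw
    (hμ.ae_mem_Icc.mono fun t ht => norm_segmentBase_le hq ht) hs).analyticOnNhd
      Metric.isOpen_ball
  have h2 := (differentiableOn_powInt (measurable_rootBase q w) hw
    (hμ.ae_mem_Icc.mono fun t ht => norm_rootBase_le hq ht) (rootExp_nonneg hlam)).analyticOnNhd
      Metric.isOpen_ball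
  refine h1.eqOn_of_preconnected_of_eventuallyEq h2 (convex_ball _ _).isPreconnected
    (Metric.mem_ball_self one_pos) ?_
  filter_upwards [Metric.ball_mem_nhds (0 : ℂ) (show (0 : ℝ) < 1 / 16 by norm_num)] with r hr
  exact hμ.powInt_segmentBase_eq_of_small hq hw (by simpa using hr)

/-- The integral representation of the kernel along a diameter of the disk. -/
theorem IsKernelMeasure.lamCauchy_polarPt (hμ : IsKernelMeasure lam μ) (hlam : 0 ≤ lam) (θ : ℝ)
    {w : ℂ} (hw : ‖w‖ < 1) {r : ℝ} (hr : r ∈ Ioo (-1 : ℝ) 1) :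
    lamCauchy lam (polarPt r θ) w =
      powInt μ (rootBase (Complex.exp (θ * Complex.I)) w) (rootExp lam) r := by
  have hq := Complex.norm_exp_ofReal_mul_I θ
  have hr' : |r| < 1 := abs_lt.2 hr
  have hz : ‖polarPt r θ‖ < 1 := by
    rw [polarPt, norm_mul, hq, mul_one, Complex.norm_real]
    exact hr'
  rw [← hμ.powInt_segmentBase_eq hlam hq hw (by simpa using hr'),
    hμ.lamCauchy_eq_integral_segment hlam hz hw]
  refine integral_congr_ae (Filter.Eventually.of_forall fun t => ?_)
  simp only [powProd, segmentBase, Fin.prod_univ_two, Matrix.cons_val_zero, Matrix.cons_val_one,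
    polarPt, map_mul, Complex.conj_ofReal]
  congr 2 <;> ring

end KernelMeasure

/-! ### The estimate -/

section Estimate

open MeasureTheory Set

variable {lam : ℝ} {μ : Measure ℝ}

theorem pow_le_two_pow_mul_pow {x : ℝ} (hx : 1 / 2 ≤ x) {k m : ℕ} (hkm : k ≤ m) :
    x ^ k ≤ 2 ^ m * x ^ m := by
  rw [← mul_pow]
  exact (pow_le_pow_left₀ (by linarith) (by linarith) k).trans
    (pow_le_pow_right₀ (by linarith) hkm)

theorem rpow_neg_two_mul_le {lam x y : ℝ} (hlam : 0 ≤ lam) (hy : 0 < y) (hyx : y ≤ x) :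
    x ^ (-2 * lam) ≤ 2 ^ (2 * lam) * (x + y) ^ (-2 * lam) := by
  calc x ^ (-2 * lam) ≤ ((x + y) / 2) ^ (-2 * lam) :=
        Real.rpow_le_rpow_of_nonpos (by linarith) (by linarith) (by linarith)
    _ = _ := by
        rw [Real.div_rpow (by linarith) zero_le_two, neg_mul, Real.rpow_neg zero_le_two]
        field_simp

/-- On `[0, 1]` the negative powers of a convex combination of positive numbers are bounded. -/
theorem integrable_convexCombo_rpow [IsFiniteMeasure μ] (hμ : ∀ᵐ t ∂μ, t ∈ Icc (0 : ℝ) 1)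
    {a b s : ℝ} (ha : 0 < a) (hb : 0 < b) (hs : s ≤ 0) :
    Integrable (fun t => ((1 - t) * a + t * b) ^ s) μ := by
  have hm : Measurable fun t : ℝ => ((1 - t) * a + t * b) ^ s :=
    Measurable.pow_const (by fun_prop) s
  refine Integrable.of_bound hm.aestronglyMeasurable (min a b ^ s) ?_
  filter_upwards [hμ] with t ht
  have h1 : min a b ≤ (1 - t) * a + t * b := by
    nlinarith [ht.1, ht.2, min_le_left a b, min_le_right a b]
  have h0 := lt_min ha hb
  rw [Real.norm_of_nonneg (Real.rpow_nonneg (h0.le.trans h1) _)]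
  exact Real.rpow_le_rpow_of_nonpos h0 h1 hs

/-- With `F = (1 - t) A² + t B²`, a bound for the integrals of `A ^ (-1 - i) F ^ (-λ - j / 2)`,
where `i + j ≤ m`. If `A ≤ B`, then `F ≥ A²` reduces it to the
integral of `F ^ (-λ)`; if `B ≤ A`, then `B² ≤ F ≤ A²` reduces it to the integral of
`F ^ (-λ - 1 / 2)`, one factor `F ^ (-1 / 2)` being kept because the integral of `F ^ (-λ)` alone
would cost a logarithm. -/
theorem IsKernelMeasure.exists_integral_le (hμ : IsKernelMeasure lam μ) (hlam : 0 ≤ lam) {m : ℕ}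
    (hm : 1 ≤ m) :
    ∃ C : ℝ, 0 ≤ C ∧ ∀ i j : ℕ, i + j ≤ m → ∀ A B : ℝ, 0 < A → A ≤ 2 → 0 < B → B ≤ 2 →
      ∫ t, A⁻¹ ^ (1 + i) * (√((1 - t) * A ^ 2 + t * B ^ 2))⁻¹ ^ j *
        ((1 - t) * A ^ 2 + t * B ^ 2) ^ (-lam) ∂μ ≤
      C * ((A + B) ^ (-2 * lam) / A * (1 / A ^ m + 1 / B ^ m)) := by
  obtain ⟨C₁, hC₁, h₁⟩ := hμ.integral_rpow_le
  obtain ⟨C₂, hC₂, h₂⟩ := hμ.integral_rpow_sub_half_le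
  have := hμ.isProbabilityMeasure
  refine ⟨2 ^ m * 2 ^ (2 * lam) * (C₁ + C₂), by positivity,
    fun i j hij A B hA hA2 hB hB2 => ?_⟩
  -- `A, B ≤ 2` allows to raise the exponent `i + j` to `m` at the cost of a factor `2 ^ m`.
  have hAi : 1 / 2 ≤ A⁻¹ := by rw [one_div]; exact inv_anti₀ hA hA2
  have hF0 : ∀ t ∈ Icc (0 : ℝ) 1, 0 < (1 - t) * A ^ 2 + t * B ^ 2 := by
    intro t ht
    have h1 : 0 ≤ 1 - t := sub_nonneg.2 ht.2
    have h0 := ht.1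
    rcases h0.eq_or_lt with rfl | h0
    · simpa using pow_pos hA 2
    · positivity
  have hnonneg : 0 ≤ᵐ[μ] fun t => A⁻¹ ^ (1 + i) * (√((1 - t) * A ^ 2 + t * B ^ 2))⁻¹ ^ j *
      ((1 - t) * A ^ 2 + t * B ^ 2) ^ (-lam) := by
    filter_upwards [hμ.ae_mem_Icc] with t ht
    have := hF0 t ht
    simp only [Pi.zero_apply]
    positivity
  rcases le_total A B with hAB | hBA
  · calc _ ≤ ∫ t, 2 ^ m * A⁻¹ ^ (1 + m) * ((1 - t) * A ^ 2 + t * B ^ 2) ^ (-lam) ∂μ := by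
          refine integral_mono_of_nonneg hnonneg ((integrable_convexCombo_rpow hμ.ae_mem_Icc
            (by positivity) (by positivity) (by linarith)).const_mul _) ?_
          filter_upwards [hμ.ae_mem_Icc] with t ht
          have hF := hF0 t ht
          have hAF : A ≤ √((1 - t) * A ^ 2 + t * B ^ 2) := by
            refine Real.le_sqrt_of_sq_le ?_
            have : A ^ 2 ≤ B ^ 2 := by gcongr
            nlinarith [ht.1]
          refine mul_le_mul_of_nonneg_right ?_ (Real.rpow_nonneg hF.le _)
          calc _ ≤ A⁻¹ ^ (1 + i) * A⁻¹ ^ j := by gcongr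
            _ = A⁻¹ * A⁻¹ ^ (i + j) := by ring
            _ ≤ A⁻¹ * (2 ^ m * A⁻¹ ^ m) := by
                gcongr
                exact pow_le_two_pow_mul_pow hAi hij
            _ = _ := by ring
      _ = 2 ^ m * A⁻¹ ^ (1 + m) * ∫ t, ((1 - t) * A ^ 2 + t * B ^ 2) ^ (-lam) ∂μ :=
          integral_const_mul _ _
      _ ≤ 2 ^ m * A⁻¹ ^ (1 + m) * (C₁ * (2 ^ (2 * lam) * (A + B) ^ (-2 * lam))) := by
          have h3 := rpow_neg_two_mul_le hlam hA hAB
          rw [add_comm B A] at h3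
          gcongr
          exact (h₁ A B hA hB).trans (by gcongr)
      _ = 2 ^ m * 2 ^ (2 * lam) * C₁ * ((A + B) ^ (-2 * lam) / A * (1 / A ^ m)) := by
          rw [pow_add, pow_one, inv_pow]
          field_simp
      _ ≤ _ := by
          gcongr
          · exact le_add_of_nonneg_right hC₂
          · exact le_add_of_nonneg_right (by positivity)
  · obtain ⟨k, rfl⟩ : ∃ k, m = k + 1 := ⟨m - 1, by omega⟩
    calc _ ≤ ∫ t, 2 ^ (k + 1) * A⁻¹ * B⁻¹ ^ k *
            ((1 - t) * A ^ 2 + t * B ^ 2) ^ (-lam - 1 / 2) ∂μ := by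
          refine integral_mono_of_nonneg hnonneg ((integrable_convexCombo_rpow hμ.ae_mem_Icc
            (by positivity) (by positivity) (by linarith)).const_mul _) ?_
          filter_upwards [hμ.ae_mem_Icc] with t ht
          have hF := hF0 t ht
          have hsq : B ^ 2 ≤ A ^ 2 := by gcongr
          have hFA : √((1 - t) * A ^ 2 + t * B ^ 2) ≤ A := by
            refine Real.sqrt_le_iff.2 ⟨hA.le, ?_⟩
            nlinarith [ht.1]
          have hBF : B ≤ √((1 - t) * A ^ 2 + t * B ^ 2) := by
            refine Real.le_sqrt_of_sq_le ?_
            nlinarith [ht.2]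
          have hN : 0 < √((1 - t) * A ^ 2 + t * B ^ 2) := Real.sqrt_pos.2 hF
          have hsplit : ((1 - t) * A ^ 2 + t * B ^ 2) ^ (-lam - 1 / 2) =
              (√((1 - t) * A ^ 2 + t * B ^ 2))⁻¹ * ((1 - t) * A ^ 2 + t * B ^ 2) ^ (-lam) := by
            rw [sub_eq_add_neg (-lam), Real.rpow_add hF, Real.rpow_neg hF.le (1 / 2),
              ← Real.sqrt_eq_rpow, mul_comm]
          have hAN : A⁻¹ ≤ (√((1 - t) * A ^ 2 + t * B ^ 2))⁻¹ := inv_anti₀ hN hFA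
          have hNB : (√((1 - t) * A ^ 2 + t * B ^ 2))⁻¹ ≤ B⁻¹ := inv_anti₀ hB hBF
          rw [hsplit, ← mul_assoc]
          refine mul_le_mul_of_nonneg_right ?_ (Real.rpow_nonneg hF.le _)
          generalize (√((1 - t) * A ^ 2 + t * B ^ 2))⁻¹ = N at *
          have hN0 : 0 < N := (inv_pos.2 hA).trans_le hAN
          calc _ = A⁻¹ * (A⁻¹ ^ i * N ^ j) := by ring
            _ ≤ A⁻¹ * (N ^ i * N ^ j) := by gcongr
            _ = A⁻¹ * N ^ (i + j) := by ring
            _ ≤ A⁻¹ * (2 ^ (k + 1) * N ^ (k + 1)) := by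
                gcongr
                exact pow_le_two_pow_mul_pow (hAi.trans hAN) hij
            _ = 2 ^ (k + 1) * A⁻¹ * N ^ k * N := by ring
            _ ≤ _ := by gcongr
      _ = 2 ^ (k + 1) * A⁻¹ * B⁻¹ ^ k *
            ∫ t, ((1 - t) * A ^ 2 + t * B ^ 2) ^ (-lam - 1 / 2) ∂μ := integral_const_mul _ _
      _ ≤ 2 ^ (k + 1) * A⁻¹ * B⁻¹ ^ k *
            (C₂ * (2 ^ (2 * lam) * (A + B) ^ (-2 * lam) / B)) := by
          have h3 := rpow_neg_two_mul_le hlam hB hBA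
          gcongr
          exact (h₂ A B hA hB hBA).trans (by gcongr)
      _ = 2 ^ (k + 1) * 2 ^ (2 * lam) * C₂ *
            ((A + B) ^ (-2 * lam) / A * (1 / B ^ (k + 1))) := by
          rw [pow_succ B, inv_pow]
          field_simp
      _ ≤ _ := by
          gcongr
          · exact le_add_of_nonneg_left hC₁
          · exact le_add_of_nonneg_left (by positivity)

theorem norm_one_sub_mul_midRoot_sq {q w : ℂ} (hq : ‖q‖ = 1) {t : ℝ} (ht : t ∈ Icc (0 : ℝ) 1)
    (r : ℝ) : ‖1 - r * midRoot q w t‖ ^ 2 =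
      (1 - t) * ‖1 - r * (q * conj w)‖ ^ 2 + t * ‖1 - r * (q * w)‖ ^ 2 := by
  have h := one_sub_midRoot_mul (w := w) hq ht r
  have hc : ∀ u : ℂ, 1 - (r : ℂ) * conj u = conj (1 - r * u) := fun u => by simp
  have h1 : conj q * w = conj (q * conj w) := by simp
  have h2 : conj q * conj w = conj (q * w) := by simp
  rw [h1, h2, hc, hc, hc, Complex.mul_conj, mul_comm (conj _) _, Complex.mul_conj,
    Complex.mul_conj, Complex.normSq_eq_norm_sq, Complex.normSq_eq_norm_sq,
    Complex.normSq_eq_norm_sq] at h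
  exact_mod_cast h

/-- The modulus of the shifted integrand in the representation by `rootBase`. -/
theorem norm_powProd_rootBase {q w : ℂ} (hq : ‖q‖ = 1) {t : ℝ} (ht : t ∈ Icc (0 : ℝ) 1) {r : ℝ}
    (hA : 0 < ‖1 - r * (q * conj w)‖) (hB : 0 < ‖1 - r * (q * w)‖) (x : Fin 3 → ℕ) :
    ‖powProd (fun l => rootBase q w l t) (rootExp lam + fun l => (x l : ℝ)) r‖ =
      ‖1 - r * (q * conj w)‖⁻¹ ^ (1 + x 0) *
      (√((1 - t) * ‖1 - r * (q * conj w)‖ ^ 2 + t * ‖1 - r * (q * w)‖ ^ 2))⁻¹ ^ (x 1 + x 2) *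
      ((1 - t) * ‖1 - r * (q * conj w)‖ ^ 2 + t * ‖1 - r * (q * w)‖ ^ 2) ^ (-lam) := by
  have hsq := norm_one_sub_mul_midRoot_sq (w := w) hq ht r
  have hconj : ‖1 - r * conj (midRoot q w t)‖ = ‖1 - r * midRoot q w t‖ := by
    rw [← Complex.norm_conj]
    simp
  have hpos : 0 < ‖1 - r * midRoot q w t‖ := by
    refine lt_of_le_of_ne (norm_nonneg _) fun h0 => ?_
    rw [← h0] at hsq
    rcases ht.1.eq_or_lt with h | h
    · rw [← h] at hsq
      nlinarith [pow_pos hA 2]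
    · nlinarith [mul_pos h (pow_pos hB 2),
        mul_nonneg (sub_nonneg.2 ht.2) (sq_nonneg ‖1 - r * (q * conj w)‖)]
  rw [norm_powProd, Fin.prod_univ_three, ← hsq, Real.sqrt_sq hpos.le]
  simp only [rootBase, rootExp, Pi.add_apply, Matrix.cons_val_zero, Matrix.cons_val_one,
    Matrix.cons_val]
  rw [hconj]
  generalize ‖1 - r * midRoot q w t‖ = N at *
  generalize ‖1 - r * (q * conj w)‖ = A at *
  have h1 : A ^ (-(1 + (x 0 : ℝ))) = A⁻¹ ^ (1 + x 0) := by
    rw [Real.rpow_neg hA.le, ← Nat.cast_one, ← Nat.cast_add, Real.rpow_natCast, inv_pow]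
  have h2 : ∀ k : ℕ, N ^ (-(lam + (k : ℝ))) = N ^ (-lam) * N⁻¹ ^ k := fun k => by
    rw [neg_add, Real.rpow_add hpos, Real.rpow_neg hpos.le (k : ℝ), Real.rpow_natCast, inv_pow]
  have h3 : (N ^ 2) ^ (-lam) = N ^ (-lam) * N ^ (-lam) := by
    rw [sq, Real.mul_rpow hpos.le hpos.le]
  rw [h1, h2, h2, h3, pow_add N⁻¹]
  ring

theorem IsKernelMeasure.contDiffOn_lamCauchy (hμ : IsKernelMeasure lam μ) (hlam : 0 ≤ lam)
    (θ : ℝ) {w : ℂ} (hw : ‖w‖ < 1) :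
    ContDiffOn ℝ ∞ (fun r : ℝ => lamCauchy lam (polarPt r θ) w) (Ioo (-1) 1) := by
  have := hμ.isProbabilityMeasure
  have hq := Complex.norm_exp_ofReal_mul_I θ
  have h1 : ContDiffOn ℂ ∞ (powInt μ (rootBase (Complex.exp (θ * Complex.I)) w) (rootExp lam))
      (Metric.ball 0 1) :=
    (differentiableOn_powInt (measurable_rootBase _ w) hw
      (hμ.ae_mem_Icc.mono fun t ht => norm_rootBase_le hq ht) (rootExp_nonneg hlam)).contDiffOn
        Metric.isOpen_ball
  have h2 := (h1.restrict_scalars ℝ).comp (s := Ioo (-1 : ℝ) 1) (f := fun r : ℝ => (r : ℂ))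
    Complex.ofRealCLM.contDiff.contDiffOn fun r hr => by simpa [abs_lt] using hr
  exact h2.congr fun r hr => hμ.lamCauchy_polarPt hlam θ hw hr

theorem iterate_eulerOp_congr {f g : ℝ → ℂ} {s : Set ℝ} (hs : IsOpen s) (h : EqOn f g s) (m : ℕ) :
    EqOn (eulerOp^[m] f) (eulerOp^[m] g) s := by
  induction m with
  | zero => exact h
  | succ m ih =>
    intro r hr
    rw [Function.iterate_succ_apply', Function.iterate_succ_apply', eulerOp, eulerOp,
      (ih.eventuallyEq_of_mem (hs.mem_nhds hr)).deriv_eq]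

theorem exists_norm_iterate_eulerOp_lamCauchy_le (hlam : 0 ≤ lam) {m : ℕ} (hm : 1 ≤ m) :
    ∃ c : ℝ, 0 < c ∧ ∀ (r θ : ℝ) (z w : ℂ), 0 ≤ r → r < 1 → z = polarPt r θ → ‖w‖ < 1 →
      ‖(eulerOp^[m] (fun s : ℝ => lamCauchy lam (polarPt s θ) w)) r‖ ≤
        c * ((‖1 - z * conj w‖ + ‖1 - z * w‖) ^ (-2 * lam) / ‖1 - z * conj w‖ *
          (1 / ‖1 - z * conj w‖ ^ m + 1 / ‖1 - z * w‖ ^ m)) := by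
  obtain ⟨μ, hμ⟩ := exists_isKernelMeasure hlam
  have := hμ.isProbabilityMeasure
  obtain ⟨C, hC, hint⟩ := hμ.exists_integral_le hlam hm
  obtain ⟨ι, _, c, x, hx, hrep⟩ :=
    exists_eulerOp_iterate_powInt (rootExp lam) (rootExp_nonneg hlam) m
  refine ⟨(∑ i, |c i|) * C + 1, by positivity, fun r θ z w hr0 hr1 hz hw => ?_⟩
  have hr : r ∈ Ioo (-1 : ℝ) 1 := ⟨by linarith, hr1⟩
  have hq := Complex.norm_exp_ofReal_mul_I θ
  set q := Complex.exp (θ * Complex.I) with hqdef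
  have hzA : z * conj w = r * (q * conj w) := by rw [hz, polarPt, mul_assoc]
  have hzB : z * w = r * (q * w) := by rw [hz, polarPt, mul_assoc]
  have hbd : ∀ u : ℂ, ‖u‖ < 1 → 0 < ‖1 - r * (q * u)‖ ∧ ‖1 - r * (q * u)‖ ≤ 2 := by
    intro u hu
    have h1 : ‖(r : ℂ) * (q * u)‖ < 1 := by
      rw [norm_mul, norm_mul, hq, one_mul, Complex.norm_real, Real.norm_of_nonneg hr0]
      nlinarith [norm_nonneg u]
    refine ⟨norm_pos_iff.2 (one_sub_ne_zero_of_norm_lt_one h1), ?_⟩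
    have h2 := norm_sub_le (1 : ℂ) (r * (q * u))
    rw [norm_one] at h2
    linarith
  obtain ⟨hA, hA2⟩ := hbd (conj w) (by simpa using hw)
  obtain ⟨hB, hB2⟩ := hbd w hw
  rw [iterate_eulerOp_congr isOpen_Ioo (fun s hs => hμ.lamCauchy_polarPt hlam θ hw hs) m hr,
    hrep μ (rootBase q w) ‖w‖ (measurable_rootBase q w) hw
      (hμ.ae_mem_Icc.mono fun t ht => norm_rootBase_le hq ht) r hr, hzA, hzB]
  set R := (‖1 - r * (q * conj w)‖ + ‖1 - r * (q * w)‖) ^ (-2 * lam) / ‖1 - r * (q * conj w)‖ *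
    (1 / ‖1 - r * (q * conj w)‖ ^ m + 1 / ‖1 - r * (q * w)‖ ^ m) with hR
  have hR0 : 0 ≤ R := by positivity
  have hterm : ∀ i, ‖powInt μ (rootBase q w) (rootExp lam + fun l => (x i l : ℝ)) r‖ ≤ C * R := by
    intro i
    have hxi := hx i
    rw [Fin.sum_univ_three] at hxi
    refine (norm_integral_le_integral_norm _).trans (le_trans (le_of_eq ?_)
      (hint (x i 0) (x i 1 + x i 2) (by omega) _ _ hA hA2 hB hB2))
    refine integral_congr_ae ?_
    filter_upwards [hμ.ae_mem_Icc] with t ht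
    exact norm_powProd_rootBase hq ht hA hB (x i)
  calc _ ≤ ∑ i, |c i| * (C * R) := by
        refine (norm_sum_le _ _).trans (Finset.sum_le_sum fun i _ => ?_)
        rw [norm_mul, Complex.norm_real, Real.norm_eq_abs]
        exact mul_le_mul_of_nonneg_left (hterm i) (abs_nonneg _)
    _ = (∑ i, |c i|) * C * R := by rw [← Finset.sum_mul, mul_assoc]
    _ ≤ _ := by nlinarith

end Estimate

theorem mainTheorem8 (lam : ℝ) (hlam : 0 ≤ lam) :
    -- the kernel and all its radial derivatives are well defined
    (∀ z w : ℂ, ‖z‖ < 1 → ‖w‖ < 1 →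
      Summable (fun n : ℕ => ‖lamPhi lam n z * conj (lamPhi lam n w)‖)) ∧
    (∀ (θ : ℝ) (w : ℂ), ‖w‖ < 1 →
      ContDiffOn ℝ ∞ (fun r : ℝ => lamCauchy lam (polarPt r θ) w) (Set.Ioo (-1) 1)) ∧
    -- the estimate
    ∀ m : ℕ, 1 ≤ m → ∃ c : ℝ, 0 < c ∧
      ∀ (r θ : ℝ) (z w : ℂ), 0 ≤ r → r < 1 → z = polarPt r θ → ‖w‖ < 1 →
        ‖(eulerOp^[m] (fun s : ℝ => lamCauchy lam (polarPt s θ) w)) r‖ ≤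
          c * ((‖1 - z * conj w‖ + ‖1 - z * w‖) ^ (-2 * lam) / ‖1 - z * conj w‖ *
            (1 / ‖1 - z * conj w‖ ^ m + 1 / ‖1 - z * w‖ ^ m)) := by
  obtain ⟨μ, hμ⟩ := exists_isKernelMeasure hlam
  exact ⟨fun z w hz hw => summable_norm_lamPhi_mul_conj hlam hz hw,
    fun θ w hw => hμ.contDiffOn_lamCauchy hlam θ hw,
    fun m hm => exists_norm_iterate_eulerOp_lamCauchy_le hlam hm⟩
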